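/- Let $D\subseteq\mathbb R$, let $F_1$ be a real reproducing kernel Hilbert space of functions on $D$ with kernel $K_1$, let $G_1$ be a real Hilbert space, and let $S_1:F_1\to G_1$ be a non-zero compact linear operator. Let $\lambda_1\ge\lambda_2\ge\dots\ge0$ be the ordered eigenvalues (with multiplicity, continued by $0$ if there are only finitely many) of $W_1=S_1^*S_1$. For a continuous linear operator $S:F\to G$ from a reproducing kernel Hilbert space to a Hilbert space, and for $\Lambda=\Lambda^{\rm std}$ (all function values on $F$) or $\Lambda=\Lambda^{\rm all}$ (all continuous linear functionals on $F$), let $e_n(S;\Lambda)$ be the infimum of $\|S-A_n\|_{F\to G}$ over all $A_nf=\sum_{j=1}^nL_j(f)\,g_j$ with $L_j\in\Lambda$, $g_j\in S(F)$. Write $e_n(S)=e_n(S;\Lambda^{\rm std})$ and ${\rm decay}_e(S)=\sup\{r\ge0:\lim_{n}n^re_n(S)=0\}\in[0,\infty]$. Let $n(\varepsilon,S)$ be the minimal $n$ for which some such $A_n$ using $n$ function values satisfies $\|S-A_n\|\le\varepsilon\|S\|$. A sequence of problems $(S_d)_{d\ge1}$ is quasi-polynomially tractable (QPT) for $\Lambda^{\rm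 std}$ if there are $C,t\ge0$ with $n(\varepsilon,S_d)\le C\exp\bigl(t(1+\ln\varepsilon^{-1})(1+\ln d)\bigr)$ for all $\varepsilon\in(0,1)$ and $d\ge1$. The tensor power $S^{\otimes d}:F^{\otimes d}\to G^{\otimes d}$ acts between Hilbert space tensor powers, and $F^{\otimes d}$ is regarded as a reproducing kernel Hilbert space of functions on the $d$-fold power of the domain, whose kernel is the product of the kernels in the individual variables. Assume that $\lambda_2<\lambda_1$ and ${\rm decay}_e(S_1)>0$, let $\eta_1\in F_1$ satisfy $\|\eta_1\|=1$ and $W_1\eta_1=\lambda_1\eta_1$, and assume that $\eta_1\ne\pm K_1(t,t)^{-1/2}K_1(\cdot,t)$ for every $t\in D$. Then there is $t^*\in D$ with $\eta_1(t^*)\ne0$, and for every such $t^*$ the following holds. Put $$\widetilde F_1=\{f\in F_1:\langle f,\eta_1\rangle=\eta_1(t^*)^{-1}f(t^*)\},\qquad \widetilde f=\eta_1-\frac{K_1(\cdot,t^*)}{\eta_1(t^*)},\qquad \widetilde S_1=S_1|_{\widetilde F_1},\qquad \widetilde W_1=\widetilde S_1^*\widetilde S_1,$$ and let $\widetilde\lambda_1\ge\widetilde\lambda_2\ge\dots$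 be the ordered eigenvalues of $\widetilde W_1$. 1. $\widetilde f\ne0$, $\widetilde F_1=\{f\in F_1:\langle f,\widetilde f\rangle=0\}$ has codimension one in $F_1$, and its reproducing kernel (with the inner product of $F_1$) is $\widetilde K_1(x,y)=K_1(x,y)-\widetilde f(x)\widetilde f(y)/\|\widetilde f\|^2$ for all $x,y\in D$. 2. $\eta_1\in\widetilde F_1$, $\widetilde K_1(t^*,t^*)>0$, and $\eta_1=\pm\widetilde K_1(t^*,t^*)^{-1/2}\widetilde K_1(\cdot,t^*)$, with the plus sign if $\eta_1(t^*)>0$; moreover $\widetilde W_1\eta_1=\widetilde\lambda_1\eta_1$. 3. $\widetilde\lambda_1=\lambda_1$ and $\widetilde\lambda_n\le\lambda_n$ for all $n\ge2$. 4. $e_n(\widetilde S_1;\Lambda)\le e_n(S_1;\Lambda)$ for all $n\ge0$ and both $\Lambda=\Lambda^{\rm std}$ and $\Lambda=\Lambda^{\rm all}$. 5. $\widetilde S_1$ is non-zero and compact, $\widetilde\lambda_2<\widetilde\lambda_1$, and ${\rm decay}_e(\widetilde S_1)>0$. 6. The modified problem $(\widetilde S_1^{\otimes d})_{d\ge1}$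 is QPT for $\Lambda^{\rm std}$. -/

import Mathlib

open Filter Topology
open scoped ENNReal NNReal TensorProduct

universe u v w

noncomputable section

/-! ### Hilbert tensor powers -/

/-- A real inner product space, bundled so that it can be the value of a recursion. -/
structure PreHilb : Type (u + 1) where
  carrier : Type u
  [nacg : NormedAddCommGroup carrier]
  [ips : InnerProductSpace ℝ carrier]

attribute [instance] PreHilb.nacg PreHilb.ips

instance uliftRealInnerProductSpace : InnerProductSpace ℝ (ULift.{u} ℝ) where
  inner x y := x.down * y.down
  norm_sq_eq_re_inner x := by
    change ‖x.down‖ ^ 2 = x.down * x.down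
    rw [Real.norm_eq_abs, sq_abs, sq]
  conj_inner_symm x y := by simp [mul_comm]
  add_left x y z := by simp [add_mul]
  smul_left x y r := by simp [mul_assoc]

/-- The `d`-fold algebraic tensor power of `H`, with the inner product for which
`⟪f₁ ⊗ ⋯ ⊗ f_d, g₁ ⊗ ⋯ ⊗ g_d⟫ = ∏ ⟪f_j, g_j⟫`. -/
def algTensorPow (H : Type u) [NormedAddCommGroup H] [InnerProductSpace ℝ H] : ℕ → PreHilb.{u}
  | 0 => ⟨ULift.{u} ℝ⟩
  | d + 1 => ⟨(algTensorPow H d).carrier ⊗[ℝ] H⟩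

/-- The elementary tensor `f₁ ⊗ ⋯ ⊗ f_d` in the algebraic tensor power. -/
def algPureTensor {H : Type u} [NormedAddCommGroup H] [InnerProductSpace ℝ H] :
    (d : ℕ) → (Fin d → H) → (algTensorPow H d).carrier
  | 0, _ => (ULift.up (1 : ℝ) : ULift.{u} ℝ)
  | d + 1, f =>
      (algPureTensor d (fun i => f i.castSucc) ⊗ₜ[ℝ] f (Fin.last d) :
        (algTensorPow H d).carrier ⊗[ℝ] H)

/-- The operator `f₁ ⊗ ⋯ ⊗ f_d ↦ S f₁ ⊗ ⋯ ⊗ S f_d` between algebraic tensor powers. -/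
def algTensorMap {H : Type u} [NormedAddCommGroup H] [InnerProductSpace ℝ H]
    {G : Type v} [NormedAddCommGroup G] [InnerProductSpace ℝ G] (S : H →L[ℝ] G) :
    (d : ℕ) → ((algTensorPow H d).carrier →L[ℝ] (algTensorPow G d).carrier)
  | 0 => (ContinuousLinearEquiv.ulift.symm.toContinuousLinearMap ∘L
      ContinuousLinearEquiv.ulift.toContinuousLinearMap : ULift.{u} ℝ →L[ℝ] ULift.{v} ℝ)
  | d + 1 => (TensorProduct.mapL (algTensorMap S d) S :
      (algTensorPow H d).carrier ⊗[ℝ] H →L[ℝ] (algTensorPow G d).carrier ⊗[ℝ] G)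

/-- The Hilbert space tensor power `H^{⊗ d}`: the completion of the algebraic tensor power. -/
def TensorPow (H : Type u) [NormedAddCommGroup H] [InnerProductSpace ℝ H] (d : ℕ) : Type u :=
  UniformSpace.Completion (algTensorPow H d).carrier

section TensorPow

variable {H : Type u} [NormedAddCommGroup H] [InnerProductSpace ℝ H]
variable {G : Type v} [NormedAddCommGroup G] [InnerProductSpace ℝ G]

instance (d : ℕ) : NormedAddCommGroup (TensorPow H d) :=
  inferInstanceAs (NormedAddCommGroup (UniformSpace.Completion (algTensorPow H d).carrier))

instance (d : ℕ) : InnerProductSpace ℝ (TensorPow H d) :=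
  inferInstanceAs (InnerProductSpace ℝ (UniformSpace.Completion (algTensorPow H d).carrier))

instance (d : ℕ) : CompleteSpace (TensorPow H d) :=
  inferInstanceAs (CompleteSpace (UniformSpace.Completion (algTensorPow H d).carrier))

/-- The dense isometric inclusion of the algebraic tensor power in its completion. -/
def algTensorIncl (H : Type u) [NormedAddCommGroup H] [InnerProductSpace ℝ H] (d : ℕ) :
    (algTensorPow H d).carrier →L[ℝ] TensorPow H d :=
  (UniformSpace.Completion.toComplL :
    (algTensorPow H d).carrier →L[ℝ] UniformSpace.Completion (algTensorPow H d).carrier)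

/-- The elementary tensor `f₁ ⊗ ⋯ ⊗ f_d` in `H^{⊗ d}`. -/
def pureTensor {d : ℕ} (f : Fin d → H) : TensorPow H d :=
  algTensorIncl H d (algPureTensor d f)

/-- The tensor power `S^{⊗ d} : H^{⊗ d} → G^{⊗ d}` of a continuous linear operator: the continuous
extension of `f₁ ⊗ ⋯ ⊗ f_d ↦ S f₁ ⊗ ⋯ ⊗ S f_d`. -/
def tensorPowMap (S : H →L[ℝ] G) (d : ℕ) : TensorPow H d →L[ℝ] TensorPow G d :=
  (algTensorIncl G d ∘L algTensorMap S d).extend (algTensorIncl H d)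

end TensorPow

/-! ### Reproducing kernels -/

section Kernels

variable {X : Type w} (F : Type u) [NormedAddCommGroup F] [InnerProductSpace ℝ F]
  [CompleteSpace F] [RKHS ℝ F X ℝ]

/-- The kernel section `K(·, t)` as an element of the reproducing kernel Hilbert space. -/
def kernelSection (t : X) : F := RKHS.kerFun F t (1 : ℝ)

/-- The real-valued reproducing kernel `K(x, y)`. -/
def realKernel (x y : X) : ℝ := RKHS.kernel F x y (1 : ℝ)

variable {F}

/-- `f = ± K(t, t)^{-1/2} K(·, t)`. -/
def IsNormalizedKernelSectionAt (f : F) (t : X) : Prop :=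
  f = (√(realKernel F t t))⁻¹ • kernelSection F t ∨
    f = -((√(realKernel F t t))⁻¹ • kernelSection F t)

theorem algTensor_functional_eq_zero (d : ℕ) (φ : (algTensorPow F d).carrier →L[ℝ] ℝ)
    (h : ∀ x : Fin d → X, φ (algPureTensor d fun i => kernelSection F (x i)) = 0) : φ = 0 := by
  induction d with
  | zero =>
    have h0 : φ (ULift.up (1 : ℝ) : ULift.{u} ℝ) = 0 := h Fin.elim0
    ext a
    have ha : a = (show ULift.{u} ℝ from a).down • (show (algTensorPow F 0).carrier from
        (ULift.up (1 : ℝ) : ULift.{u} ℝ)) := by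
      apply ULift.ext
      change _ = (show ULift.{u} ℝ from a).down * 1
      rw [mul_one]
    rw [ha, map_smul]
    simpa using Or.inr h0
  | succ d ih =>
    let ψ : (algTensorPow F d).carrier ⊗[ℝ] F →L[ℝ] ℝ := φ
    have h1 : ∀ (y : X) (a : (algTensorPow F d).carrier), ψ (a ⊗ₜ kernelSection F y) = 0 := by
      intro y
      have := ih (ψ ∘L (TensorProduct.mkL ℝ _ F).flip (kernelSection F y)) (by
        intro x
        have := h (Fin.snoc (α := fun _ => X) x y)
        simp only [algPureTensor, Fin.snoc_castSucc, Fin.snoc_last] at this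
        exact this)
      intro a
      exact DFunLike.congr_fun this a
    have h2 : ∀ (a : (algTensorPow F d).carrier) (f : F), ψ (a ⊗ₜ f) = 0 := by
      intro a
      let χ : F →L[ℝ] ℝ := ψ ∘L TensorProduct.mkL ℝ _ F a
      have hχ : χ = 0 := by
        refine ContinuousLinearMap.ext_on
          (s := {RKHS.kerFun F x v | (x : X) (v : ℝ)}) ?_ ?_
        · have := RKHS.kerFun_dense F
          rw [dense_iff_closure_eq, ← Submodule.topologicalClosure_coe, this]
          rfl
        · rintro _ ⟨x, v, rfl⟩
          have hv : RKHS.kerFun F x v = v • kernelSection F x := by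
            rw [kernelSection, ← map_smul, smul_eq_mul, mul_one]
          rw [hv, map_smul]
          have : χ (kernelSection F x) = 0 := h1 x a
          simp [this]
      intro f
      exact DFunLike.congr_fun hχ f
    have h3 : ψ.toLinearMap = 0 := TensorProduct.ext' (fun a f => by simpa using h2 a f)
    ext a
    exact DFunLike.congr_fun h3 a

/-- `F^{⊗ d}` as a space of functions on `X^d`: the value of `f` at `x = (x₁, …, x_d)` is
`⟪K(·, x₁) ⊗ ⋯ ⊗ K(·, x_d), f⟫`, that is, the reproducing kernel is `∏ K(x_j, y_j)` and
elementary tensors act as `(f₁ ⊗ ⋯ ⊗ f_d) x = ∏ f_j (x_j)`. -/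
instance tensorPowRKHS (d : ℕ) : RKHS ℝ (TensorPow F d) (Fin d → X) ℝ where
  coeCLM := ContinuousLinearMap.pi fun x =>
    innerSL ℝ (pureTensor fun i => kernelSection F (x i))
  coeCLM_injective := by
    refine (injective_iff_map_eq_zero _).mpr fun f hf => ?_
    have h : (innerSL ℝ f) ∘L algTensorIncl F d = 0 := by
      refine algTensor_functional_eq_zero (X := X) d _ fun x => ?_
      have := congrFun hf x
      simp only [ContinuousLinearMap.coe_pi', innerSL_apply_apply, Pi.zero_apply] at this
      rw [ContinuousLinearMap.comp_apply, innerSL_apply_apply, real_inner_comm]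
      exact this
    have hd : DenseRange (algTensorIncl F d) :=
      UniformSpace.Completion.denseRange_coe (α := (algTensorPow F d).carrier)
    have h' : innerSL ℝ f = 0 := by
      apply DFunLike.coe_injective
      exact hd.equalizer (innerSL ℝ f).continuous continuous_const
        (funext fun a => DFunLike.congr_fun h a)
    have := DFunLike.congr_fun h' f
    simpa using this

/-- A linear subspace, with the restricted inner product, as a space of functions. -/
instance submoduleRKHS (P : Submodule ℝ F) : RKHS ℝ P X ℝ where
  coeCLM := RKHS.coeCLM ℝ ∘L P.subtypeL
  coeCLM_injective := RKHS.coeCLM_injective.comp P.injective_subtype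

/-- The subspace `{f ∈ F : ⟪f, η⟫ = η(t)⁻¹ f(t)}`. -/
def modifiedSpace (η : F) (t : X) : Submodule ℝ F where
  carrier := {f | inner ℝ f η = (η t)⁻¹ * f t}
  add_mem' {f g} hf hg := by
    simp only [Set.mem_ofPred_eq] at hf hg ⊢
    rw [inner_add_left, hf, hg, RKHS.coe_add, Pi.add_apply, mul_add]
  zero_mem' := by simp
  smul_mem' c f hf := by
    simp only [Set.mem_ofPred_eq] at hf ⊢
    rw [real_inner_smul_left, hf, RKHS.coe_smul, Pi.smul_apply, smul_eq_mul]
    ring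

instance modifiedSpace_completeSpace (η : F) (t : X) : CompleteSpace (modifiedSpace η t) := by
  refine IsClosed.completeSpace_coe (hs := ?_)
  change IsClosed {f : F | inner ℝ f η = (η t)⁻¹ * f t}
  exact isClosed_eq (by fun_prop) (continuous_const.mul (RKHS.continuous_eval t))

/-- The function `η - K(·, t) / η(t)`. -/
def modifier (η : F) (t : X) : F := η - (η t)⁻¹ • kernelSection F t

end Kernels

/-! ### Algorithms, minimal errors, information complexity, tractability -/

section Complexity

variable {X : Type w} {F : Type u} [NormedAddCommGroup F] [InnerProductSpace ℝ F]
  {G : Type v} [NormedAddCommGroup G] [InnerProductSpace ℝ G]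

/-- The class `Λ^all` of all continuous linear functionals. -/
def allInfo (F : Type u) [NormedAddCommGroup F] [InnerProductSpace ℝ F] :
    Set (F →L[ℝ] ℝ) := Set.univ

/-- The class `Λ^std` of function values. -/
def stdInfo (F : Type u) [NormedAddCommGroup F] [InnerProductSpace ℝ F] [RKHS ℝ F X ℝ] :
    Set (F →L[ℝ] ℝ) :=
  Set.range fun t : X => ContinuousLinearMap.proj t ∘L RKHS.coeCLM ℝ (H := F)

/-- The algorithms `A f = ∑_{j ≤ n} L_j(f) g_j` with `L_j ∈ Λ` and `g_j ∈ S(F)`. -/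
def algorithms (Λ : Set (F →L[ℝ] ℝ)) (S : F →L[ℝ] G) (n : ℕ) : Set (F →L[ℝ] G) :=
  {A | ∃ (L : Fin n → F →L[ℝ] ℝ) (g : Fin n → G), (∀ j, L j ∈ Λ) ∧ (∀ j, g j ∈ Set.range S) ∧
    A = ∑ j, (L j).smulRight (g j)}

/-- The `n`-th minimal worst case error: the infimum of `‖S - A‖` over algorithms that use
`n` functionals from `Λ`. -/
def minimalError (Λ : Set (F →L[ℝ] ℝ)) (S : F →L[ℝ] G) (n : ℕ) : ℝ :=
  sInf ((fun A => ‖S - A‖) '' algorithms Λ S n)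

/-- The information complexity `n(ε, S)` for the normalized error criterion
(`⊤` if no algorithm achieves the error). -/
def infoComplexity (Λ : Set (F →L[ℝ] ℝ)) (S : F →L[ℝ] G) (ε : ℝ) : ℕ∞ :=
  ⨅ (n : ℕ) (_ : ∃ A ∈ algorithms Λ S n, ‖S - A‖ ≤ ε * ‖S‖), (n : ℕ∞)

/-- The polynomial decay `sup {r ≥ 0 : lim n^r a_n = 0}` of a sequence, possibly `∞`. -/
def decay (a : ℕ → ℝ) : ℝ≥0∞ :=
  ⨆ (r : ℝ≥0) (_ : Tendsto (fun n : ℕ => (n : ℝ) ^ (r : ℝ) * a n) atTop (𝓝 0)), (r : ℝ≥0∞)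

/-- The `n`-th largest eigenvalue (`n ≥ 1`, counted with multiplicity) of a compact positive
self-adjoint operator: the largest `μ` such that the eigenspaces for eigenvalues `≥ μ` have total
dimension at least `n`. It is `0` if there are fewer than `n` positive eigenvalues. -/
def orderedEigenvalue (T : F →L[ℝ] F) (n : ℕ) : ℝ :=
  sSup {μ : ℝ | (n : Cardinal) ≤ Module.rank ℝ
    (⨆ ν ∈ Set.Ici μ, Module.End.eigenspace (T : Module.End ℝ F) ν : Submodule ℝ F)}

end Complexity

/-- Quasi-polynomial tractability for `Λ^std` of a sequence of problems `S_d`, `d ≥ 1`. -/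
def IsQPTStd {X : ℕ → Type w} {F : ℕ → Type u} {G : ℕ → Type v}
    [∀ d, NormedAddCommGroup (F d)] [∀ d, InnerProductSpace ℝ (F d)]
    [∀ d, RKHS ℝ (F d) (X d) ℝ]
    [∀ d, NormedAddCommGroup (G d)] [∀ d, InnerProductSpace ℝ (G d)]
    (S : ∀ d, F d →L[ℝ] G d) : Prop :=
  ∃ C t : ℝ, 0 ≤ C ∧ 0 ≤ t ∧ ∀ ε : ℝ, 0 < ε → ε < 1 → ∀ d : ℕ, 1 ≤ d →
    (infoComplexity (stdInfo (F d)) (S d) ε : ℝ≥0∞) ≤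
      ENNReal.ofReal (C * Real.exp (t * (1 + Real.log ε⁻¹) * (1 + Real.log d)))

end

/-! ### Compact positive operators -/

section Spectral

variable {E : Type u} [NormedAddCommGroup E] [InnerProductSpace ℝ E]

/-! The modified space is the orthogonal complement of `modifier η t`, by the reproducing property.
On it `f(t) = η(t)⟪η, f⟫`: evaluation at `t` represents the top singular direction, so `η` is a
normalized kernel section there. Since `η` itself survives the restriction, the top eigenvalue is
unchanged. The other eigenvalues cannot grow, by a min-max argument
(`orderedEigenvalue_restrict_le`). Minimal errors cannot grow because the outputs of an algorithm
may be projected onto the closed range of the restriction. Hence the spectral gap and the polynomial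
decay pass to the restricted operator, again called `S` below.

For tractability, split `S` into its leading part `⟪η, ·⟫ S η`, which now costs one function value,
and a remainder of norm at most `ρ < ‖S η‖`. The remainder vanishes at `η` and has range orthogonal
to `S η`. Polynomial decay expands it into levels `Δ l` of geometrically growing cost and
geometrically decreasing norm (`exists_isMultilevel`). A tensor power is treated one factor at a
time (`exists_algorithm_mapL`): the leading part is paired with an `ε`-approximation of the lower
power, and `Δ l` with a cruder `a l * ε`-approximation. Leading and remaining errors are orthogonal
in both source and target, so their norms combine by a maximum and the relative error stays `ε` in
every dimension.

The cost obeys `n ≤ (1 + b)^d ε^(-p)` as soon as `b` bounds the sums of `m l * a l ^ (-p)`. All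
weights exceed `1` by a fixed factor, so an exponent `p` proportional to `1 + ln d` makes `b = 1/d`
possible (`exists_exponent_sum_le`). Then `(1 + 1/d)^d ≤ e`, which leaves a quasi-polynomial bound.
-/

theorem exists_eigenvector_norm [CompleteSpace E] {T : E →L[ℝ] E} (hT : IsCompactOperator T)
    (hpos : T.IsPositive) (hn : ‖T‖ ≠ 0) : ∃ w : E, w ≠ 0 ∧ T w = ‖T‖ • w := by
  -- For a self-adjoint operator the spectral radius is the norm. It is attained at a spectral
  -- point, which is an eigenvalue by compactness, and positivity rules out `-‖T‖`.
  have hsr := T.spectralRadius_eq_nnnorm hpos.isSelfAdjoint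
  have hne : (spectrum ℝ T).Nonempty := by
    by_contra h
    rw [Set.not_nonempty_iff_eq_empty] at h
    rw [spectralRadius, h] at hsr
    simp at hsr
    exact hn (by rw [← coe_nnnorm, ← hsr]; rfl)
  obtain ⟨k, hk, hk'⟩ := spectrum.exists_nnnorm_eq_spectralRadius_of_nonempty hne
  rw [hsr] at hk'
  have hk2 : |k| = ‖T‖ := by
    have := ENNReal.coe_injective hk'
    rw [← Real.norm_eq_abs, ← coe_nnnorm, this, coe_nnnorm]
  have hk0 : k ≠ 0 := by
    rintro rfl
    exact hn (by rw [← hk2, abs_zero])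
  have hev := (hT.hasEigenvalue_iff_mem_spectrum hk0).mpr hk
  obtain ⟨w, hw⟩ := hev.exists_hasEigenvector
  have hTw : T w = k • w := hw.apply_eq_smul
  have hkpos : 0 ≤ k := by
    have h1 := hpos.inner_nonneg_left w
    rw [hTw, real_inner_smul_left, real_inner_self_eq_norm_sq] at h1
    have h2 : 0 < ‖w‖ ^ 2 := by have := norm_pos_iff.mpr hw.2; positivity
    exact nonneg_of_mul_nonneg_left h1 h2
  exact ⟨w, hw.2, by rw [hTw, ← hk2, abs_of_nonneg hkpos]⟩

/-- If the Rayleigh quotient of a compact positive operator is at least `μ > 0` somewhere on a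
closed invariant subspace, then this subspace contains an eigenvector with eigenvalue `≥ μ`. -/
theorem exists_eigenvector_of_le_rayleigh [CompleteSpace E] {T : E →L[ℝ] E}
    (hT : IsCompactOperator T)
    (hpos : T.IsPositive) (U : Submodule ℝ E) [CompleteSpace U] (hU : ∀ x ∈ U, T x ∈ U)
    {μ : ℝ} (hμ : 0 < μ) {v : E} (hv : v ∈ U) (hv0 : v ≠ 0) (hle : μ * ‖v‖ ^ 2 ≤ inner ℝ (T v) v) :
    ∃ w ∈ U, w ≠ 0 ∧ ∃ ν, μ ≤ ν ∧ T w = ν • w := by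
  let TU : U →L[ℝ] U := T.restrict hU
  have hTU : IsCompactOperator TU := hT.restrict' hU
  have hposU : TU.IsPositive := by
    rw [ContinuousLinearMap.isPositive_iff]
    refine ⟨hpos.isSymmetric.restrict_invariant hU, fun x => ?_⟩
    exact hpos.inner_nonneg_left (x : E)
  have hvp : 0 < ‖v‖ := norm_pos_iff.mpr hv0
  have hnorm : μ ≤ ‖TU‖ := by
    have h1 : inner ℝ (T v) v ≤ ‖TU‖ * ‖v‖ ^ 2 := by
      have h2 := TU.le_opNorm ⟨v, hv⟩
      have h3 : ‖T v‖ ≤ ‖TU‖ * ‖v‖ := h2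
      calc inner ℝ (T v) v ≤ ‖T v‖ * ‖v‖ := real_inner_le_norm _ _
        _ ≤ (‖TU‖ * ‖v‖) * ‖v‖ := by gcongr
        _ = _ := by ring
    have h4 : 0 < ‖v‖ ^ 2 := by positivity
    exact le_of_mul_le_mul_right (hle.trans h1) h4
  have hne : ‖TU‖ ≠ 0 := (hμ.trans_le hnorm).ne'
  obtain ⟨w, hw0, hw⟩ := exists_eigenvector_norm hTU hposU hne
  exact ⟨w, w.2, by simpa using hw0, ‖TU‖, hnorm, congrArg Subtype.val hw⟩

/-- The sum of the eigenspaces for eigenvalues `≥ μ`. -/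
def upperEigenspace (T : E →L[ℝ] E) (μ : ℝ) : Submodule ℝ E :=
  ⨆ ν ∈ Set.Ici μ, Module.End.eigenspace (T : Module.End ℝ E) ν

theorem orderedEigenvalue_eq_sSup (T : E →L[ℝ] E) (n : ℕ) :
    orderedEigenvalue T n = sSup {μ : ℝ | (n : Cardinal) ≤ Module.rank ℝ (upperEigenspace T μ)} :=
  rfl

theorem mem_upperEigenspace {T : E →L[ℝ] E} {μ ν : ℝ} (h : μ ≤ ν) {v : E} (hv : T v = ν • v) :
    v ∈ upperEigenspace T μ :=
  Submodule.mem_iSup_of_mem ν (Submodule.mem_iSup_of_mem h (Module.End.mem_eigenspace_iff.mpr hv))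

theorem map_mem_upperEigenspace {T : E →L[ℝ] E} {μ : ℝ} {v : E} (hv : v ∈ upperEigenspace T μ) :
    T v ∈ upperEigenspace T μ := by
  have : upperEigenspace T μ ≤ (upperEigenspace T μ).comap (T : E →ₗ[ℝ] E) := by
    refine iSup₂_le fun ν hν x hx => ?_
    have hx' : T x = ν • x := Module.End.mem_eigenspace_iff.mp hx
    change T x ∈ upperEigenspace T μ
    rw [hx']
    exact Submodule.smul_mem _ _ (mem_upperEigenspace hν hx')
  exact this hv

/-- Eigenspaces of a symmetric operator are mutually orthogonal, so on a finite sum of eigenvectors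
the Rayleigh quotient is a weighted mean of eigenvalues that are all at least `μ`. -/
theorem le_rayleigh_of_mem_upperEigenspace {T : E →L[ℝ] E} (hT : T.IsSymmetric) {μ : ℝ} {v : E}
    (hv : v ∈ upperEigenspace T μ) : μ * ‖v‖ ^ 2 ≤ inner ℝ (T v) v := by
  rw [upperEigenspace, iSup_subtype', Submodule.mem_iSup_iff_exists_finsupp] at hv
  obtain ⟨f, hf, rfl⟩ := hv
  have hfam := hT.orthogonalFamily_eigenspaces.comp
    (γ := Set.Ici μ) (f := Subtype.val) Subtype.val_injective
  let g : ∀ i : Set.Ici μ, Module.End.eigenspace (T : Module.End ℝ E) i := fun i => ⟨f i, hf i⟩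
  have hTf : ∀ i, T (f i) = (i : ℝ) • f i := fun i => Module.End.mem_eigenspace_iff.mp (hf i)
  have h1 : T (f.sum fun _ x => x) = ∑ i ∈ f.support, ((i : ℝ) • g i : E) := by
    rw [Finsupp.sum, map_sum]
    exact Finset.sum_congr rfl fun i _ => hTf i
  have h2 := hfam.inner_sum (fun i => (i : ℝ) • g i) g f.support
  have h3 := hfam.inner_sum g g f.support
  change inner ℝ (∑ i ∈ f.support, ((i : ℝ) • g i : E)) (∑ i ∈ f.support, (g i : E)) = _ at h2
  change inner ℝ (∑ i ∈ f.support, (g i : E)) (∑ i ∈ f.support, (g i : E)) = _ at h3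
  have h4 : (f.sum fun _ x => x) = ∑ i ∈ f.support, (g i : E) := rfl
  rw [h1, h4]
  rw [← real_inner_self_eq_norm_sq, h3]
  refine le_of_le_of_eq ?_ h2.symm
  rw [Finset.mul_sum]
  refine Finset.sum_le_sum fun i _ => ?_
  rw [real_inner_smul_left]
  exact mul_le_mul_of_nonneg_right i.2 real_inner_self_nonneg

/-- Gives the upper bound that makes the `sSup` in `orderedEigenvalue` a true supremum. For `n = 0`
every `μ` qualifies and there is no bound. -/
theorem le_norm_of_rank_upperEigenspace {T : E →L[ℝ] E} (hT : T.IsSymmetric) {n : ℕ} (hn : 1 ≤ n)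
    {μ : ℝ} (hμ : (n : Cardinal) ≤ Module.rank ℝ (upperEigenspace T μ)) : μ ≤ ‖T‖ := by
  have hne : upperEigenspace T μ ≠ ⊥ := by
    intro h
    rw [h, rank_bot] at hμ
    have : n = 0 := by simpa using hμ
    omega
  obtain ⟨v, hv, hv0⟩ := Submodule.exists_mem_ne_zero_of_ne_bot hne
  have h1 := le_rayleigh_of_mem_upperEigenspace hT hv
  have h4 : 0 < ‖v‖ ^ 2 := by have := norm_pos_iff.mpr hv0; positivity
  refine le_of_mul_le_mul_right (h1.trans ?_) h4
  calc inner ℝ (T v) v ≤ ‖T v‖ * ‖v‖ := real_inner_le_norm _ _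
    _ ≤ (‖T‖ * ‖v‖) * ‖v‖ := by gcongr; exact T.le_opNorm v
    _ = _ := by ring

theorem le_orderedEigenvalue {T : E →L[ℝ] E} (hT : T.IsSymmetric) {n : ℕ} (hn : 1 ≤ n)
    {μ : ℝ} (hμ : (n : Cardinal) ≤ Module.rank ℝ (upperEigenspace T μ)) :
    μ ≤ orderedEigenvalue T n :=
  le_csSup ⟨‖T‖, fun _ h => le_norm_of_rank_upperEigenspace hT hn h⟩ hμ

/-- A positive operator has no negative eigenvalues, so lowering `μ` below `0` adds nothing. Hence
the set defining `orderedEigenvalue` contains `0` whenever it is nonempty. -/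
theorem upperEigenspace_le_of_isPositive {T : E →L[ℝ] E} (hT : T.IsPositive) (μ : ℝ) :
    upperEigenspace T μ ≤ upperEigenspace T 0 := by
  refine iSup₂_le fun ν _ x hx => ?_
  have hx' : T x = ν • x := Module.End.mem_eigenspace_iff.mp hx
  by_cases hx0 : x = 0
  · rw [hx0]; exact Submodule.zero_mem _
  refine mem_upperEigenspace ?_ hx'
  have h1 := hT.inner_nonneg_left x
  rw [hx', real_inner_smul_left, real_inner_self_eq_norm_sq] at h1
  have h2 : 0 < ‖x‖ ^ 2 := by have := norm_pos_iff.mpr hx0; positivity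
  exact nonneg_of_mul_nonneg_left h1 h2

theorem orderedEigenvalue_nonneg {T : E →L[ℝ] E} (hT : T.IsPositive) (n : ℕ) :
    0 ≤ orderedEigenvalue T n := by
  rw [orderedEigenvalue_eq_sSup]
  rcases Set.eq_empty_or_nonempty
    {μ : ℝ | (n : Cardinal) ≤ Module.rank ℝ (upperEigenspace T μ)} with h | ⟨μ, hμ⟩
  · rw [h, Real.sSup_empty]
  · exact Real.sSup_nonneg' ⟨0, (show (n : Cardinal) ≤ _ from hμ).trans
      (Submodule.rank_mono (upperEigenspace_le_of_isPositive hT μ)), le_rfl⟩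

end Spectral

/-! ### Eigenvalues under restriction, and the spectral gap -/

section Restriction

variable {E : Type u} [NormedAddCommGroup E] [InnerProductSpace ℝ E] [CompleteSpace E]
variable {G : Type v} [NormedAddCommGroup G] [InnerProductSpace ℝ G] [CompleteSpace G]

theorem inner_adjoint_comp_self (S : E →L[ℝ] G) (v : E) :
    inner ℝ ((S.adjoint ∘L S) v) v = ‖S v‖ ^ 2 := by
  rw [ContinuousLinearMap.comp_apply, ContinuousLinearMap.adjoint_inner_left,
    real_inner_self_eq_norm_sq]

/-- Min-max argument. If `dim V < n ≤ dim V'`, some nonzero `x` in `V'` is orthogonal to `V`, and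
its Rayleigh quotient for `S* S` is at least `μ`. Then the invariant subspace `Vᗮ` contains an
eigenvector with eigenvalue at least `μ`; this vector also lies in `V`, which is absurd. -/
theorem orderedEigenvalue_restrict_le {S : E →L[ℝ] G} (hS : IsCompactOperator S)
    (P : Submodule ℝ E) [CompleteSpace P] {n : ℕ} (hn : 1 ≤ n) :
    orderedEigenvalue ((S ∘L P.subtypeL).adjoint ∘L (S ∘L P.subtypeL)) n ≤
      orderedEigenvalue (S.adjoint ∘L S) n := by
  set S' := S ∘L P.subtypeL with hS'
  have hpos : (S.adjoint ∘L S).IsPositive := ContinuousLinearMap.isPositive_adjoint_comp_self S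
  have hpos' : (S'.adjoint ∘L S').IsPositive := ContinuousLinearMap.isPositive_adjoint_comp_self S'
  have hcpt : IsCompactOperator (S.adjoint ∘L S) := hS.clm_comp S.adjoint
  refine Real.sSup_le (fun μ hμ => ?_) (orderedEigenvalue_nonneg hpos n)
  rcases le_or_gt μ 0 with h0 | h0
  · exact h0.trans (orderedEigenvalue_nonneg hpos n)
  refine le_orderedEigenvalue hpos.isSymmetric hn ?_
  by_contra hlt
  rw [not_le] at hlt
  set V := upperEigenspace (S.adjoint ∘L S) μ with hV
  set V' := upperEigenspace (S'.adjoint ∘L S') μ with hV'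
  replace hμ : (n : Cardinal) ≤ Module.rank ℝ V' := hμ
  have : FiniteDimensional ℝ V :=
    Module.rank_lt_aleph0_iff.mp (hlt.trans (Cardinal.natCast_lt_aleph0))
  let p : V' →ₗ[ℝ] V := V.orthogonalProjectionOnto.toLinearMap ∘ₗ P.subtype ∘ₗ V'.subtype
  have hp : ¬ Function.Injective p := fun hinj =>
    absurd (hμ.trans (LinearMap.rank_le_of_injective p hinj)) (not_le.mpr hlt)
  rw [← LinearMap.ker_eq_bot] at hp
  obtain ⟨x, hx, hx0⟩ := Submodule.exists_mem_ne_zero_of_ne_bot hp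
  have hxV : ((x : P) : E) ∈ Vᗮ :=
    Submodule.orthogonalProjectionOnto_eq_zero_iff.mp (LinearMap.mem_ker.mp hx)
  have hx0' : ((x : P) : E) ≠ 0 := by simpa using hx0
  have hle := le_rayleigh_of_mem_upperEigenspace hpos'.isSymmetric x.2
  rw [inner_adjoint_comp_self] at hle
  obtain ⟨w, hw, hw0, ν, hν, hTw⟩ := exists_eigenvector_of_le_rayleigh hcpt hpos Vᗮ
    (fun y hy z hz => by
      rw [← ContinuousLinearMap.coe_coe, ← hpos.isSymmetric]
      exact hy _ (map_mem_upperEigenspace hz))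
    h0 hxV hx0' (by rw [inner_adjoint_comp_self]; exact hle)
  have hwV : w ∈ V := mem_upperEigenspace hν hTw
  exact hw0 (inner_self_eq_zero.mp (hw w hwV))

/-- On the orthogonal complement of a top eigenvector, the operator has smaller norm if the top
eigenvalue is simple. -/
theorem exists_norm_le_on_orthogonal {S : E →L[ℝ] G} (hS : IsCompactOperator S)
    (hgap : orderedEigenvalue (S.adjoint ∘L S) 2 < orderedEigenvalue (S.adjoint ∘L S) 1)
    {η : E} (hη : ‖η‖ = 1)
    (hη_eig : S.adjoint (S η) = orderedEigenvalue (S.adjoint ∘L S) 1 • η) :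
    ∃ ρ : ℝ, 0 < ρ ∧ ρ < ‖S η‖ ∧ ∀ v, inner ℝ η v = 0 → ‖S v‖ ≤ ρ * ‖v‖ := by
  have hpos : (S.adjoint ∘L S).IsPositive := ContinuousLinearMap.isPositive_adjoint_comp_self S
  have hcpt : IsCompactOperator (S.adjoint ∘L S) := hS.clm_comp S.adjoint
  set a := orderedEigenvalue (S.adjoint ∘L S) 1 with ha
  set b := orderedEigenvalue (S.adjoint ∘L S) 2 with hb
  have hb0 : 0 ≤ b := orderedEigenvalue_nonneg hpos 2
  have hη0 : η ≠ 0 := by rintro rfl; simp at hη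
  have hSη : ‖S η‖ ^ 2 = a := by
    rw [← inner_adjoint_comp_self, ContinuousLinearMap.comp_apply, hη_eig, real_inner_smul_left,
      real_inner_self_eq_norm_sq, hη]; ring
  -- Any value strictly between the two top eigenvalues would do. A vector orthogonal to `η` that
  -- violates the bound `√μ` yields an eigenvector `w ⊥ η` with eigenvalue at least `μ`; together
  -- with `η` it forces the second eigenvalue up to `μ`.
  set μ := (a + b) / 2 with hμ
  have hμ0 : 0 < μ := by linarith
  refine ⟨√μ, Real.sqrt_pos.mpr hμ0, ?_, fun v hv => ?_⟩
  · rw [← Real.sqrt_sq (norm_nonneg (S η)), hSη]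
    exact Real.sqrt_lt_sqrt hμ0.le (by linarith)
  by_contra hlt
  rw [not_le] at hlt
  have hv0 : v ≠ 0 := by rintro rfl; simp at hlt
  have hle : μ * ‖v‖ ^ 2 ≤ ‖S v‖ ^ 2 := by
    have : (√μ * ‖v‖) ^ 2 ≤ ‖S v‖ ^ 2 := by gcongr
    rwa [mul_pow, Real.sq_sqrt hμ0.le] at this
  obtain ⟨w, hw, hw0, ν, hν, hTw⟩ := exists_eigenvector_of_le_rayleigh hcpt hpos (ℝ ∙ η)ᗮ
    (fun y hy => by
      rw [Submodule.mem_orthogonal_singleton_iff_inner_right] at hy ⊢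
      rw [ContinuousLinearMap.comp_apply, ContinuousLinearMap.adjoint_inner_right,
        ← ContinuousLinearMap.adjoint_inner_left, hη_eig, real_inner_smul_left, hy, mul_zero])
    hμ0 (Submodule.mem_orthogonal_singleton_iff_inner_right.mpr hv) hv0
    (by rw [inner_adjoint_comp_self]; exact hle)
  rw [Submodule.mem_orthogonal_singleton_iff_inner_right] at hw
  have hrank : ((2 : ℕ) : Cardinal) ≤ Module.rank ℝ (upperEigenspace (S.adjoint ∘L S) μ) := by
    have hmem1 : η ∈ upperEigenspace (S.adjoint ∘L S) μ :=
      mem_upperEigenspace (ν := a) (by linarith) hη_eig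
    have hmem2 : w ∈ upperEigenspace (S.adjoint ∘L S) μ := mem_upperEigenspace hν hTw
    have hli : LinearIndependent ℝ
        ![(⟨η, hmem1⟩ : upperEigenspace (S.adjoint ∘L S) μ), ⟨w, hmem2⟩] := by
      apply linearIndependent_of_ne_zero_of_inner_eq_zero
      · intro i
        fin_cases i <;> simp [hη0, hw0]
      · intro i j hij
        fin_cases i <;> fin_cases j <;> simp_all [real_inner_comm]
    simpa using hli.cardinal_lift_le_rank
  have := le_orderedEigenvalue hpos.isSymmetric (by norm_num) hrank
  linarith

end Restriction

/-! ### The modified space -/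

section ModifiedSpace

variable {X : Type w} {F : Type u} [NormedAddCommGroup F] [InnerProductSpace ℝ F]
  [CompleteSpace F] [RKHS ℝ F X ℝ]

theorem inner_kernelSection_right (f : F) (t : X) : inner ℝ f (kernelSection F t) = f t := by
  rw [kernelSection, RKHS.inner_kerFun]
  simp

theorem inner_kernelSection_left (f : F) (t : X) : inner ℝ (kernelSection F t) f = f t := by
  rw [real_inner_comm, inner_kernelSection_right]

theorem realKernel_eq (x y : X) : realKernel F x y = kernelSection F y x :=
  (RKHS.kerFun_apply F y 1 x).symm

theorem kernelSection_eq_of_forall_inner {g : F} {t : X} (h : ∀ f : F, inner ℝ g f = f t) :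
    kernelSection F t = g :=
  ext_inner_right ℝ fun f => by rw [inner_kernelSection_left, h]

omit [CompleteSpace F] in
theorem submodule_coe_apply (P : Submodule ℝ F) (f : P) (x : X) : f x = (f : F) x := rfl

theorem mem_modifiedSpace_iff {η : F} {t : X} {f : F} :
    f ∈ modifiedSpace η t ↔ inner ℝ f (modifier η t) = 0 := by
  rw [modifier, inner_sub_right, real_inner_smul_right, inner_kernelSection_right, sub_eq_zero]
  rfl

/-- If the modifier vanished, then `K(·, t) = η(t) η` and `K(t, t) = η(t)²`, so `η` would be a
normalized kernel section, with the sign of `η(t)`. -/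
theorem modifier_ne_zero {η : F} {t : X} (ht : η t ≠ 0)
    (hsec : ¬ IsNormalizedKernelSectionAt η t) : modifier η t ≠ 0 := by
  intro h
  rw [modifier, sub_eq_zero] at h
  have hK : kernelSection F t = η t • η := (inv_smul_eq_iff₀ ht).mp h.symm
  apply hsec
  have hsq : √(realKernel F t t) = |η t| := by
    rw [realKernel_eq, hK, RKHS.coe_smul, Pi.smul_apply, smul_eq_mul, Real.sqrt_mul_self_eq_abs]
  rw [IsNormalizedKernelSectionAt, hsq, hK, smul_smul]
  rcases lt_or_gt_of_ne ht with h0 | h0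
  · right
    rw [abs_of_neg h0, inv_neg, neg_mul, inv_mul_cancel₀ ht, neg_smul, neg_neg, one_smul]
  · left
    rw [abs_of_pos h0, inv_mul_cancel₀ ht, one_smul]

theorem finrank_quotient_modifiedSpace {η : F} {t : X} (h : modifier η t ≠ 0) :
    Module.finrank ℝ (F ⧸ modifiedSpace η t) = 1 := by
  have hker : modifiedSpace η t = LinearMap.ker (innerₛₗ ℝ (modifier η t)) := by
    ext f
    rw [mem_modifiedSpace_iff, LinearMap.mem_ker, innerₛₗ_apply_apply, real_inner_comm]
  have hsurj : Function.Surjective (innerₛₗ ℝ (modifier η t)) := by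
    apply LinearMap.surjective
    intro h0
    apply h
    have := DFunLike.congr_fun h0 (modifier η t)
    simpa using this
  rw [hker, ((innerₛₗ ℝ (modifier η t)).quotKerEquivOfSurjective hsurj).finrank_eq,
    Module.finrank_self]

/-- The kernel section of a closed subspace is the orthogonal projection of the original one; here
this removes the component along the modifier. -/
theorem coe_kernelSection_modifiedSpace {η : F} {t : X} (h : modifier η t ≠ 0) (y : X) :
    (kernelSection (modifiedSpace η t) y : F) = kernelSection F y -
      (modifier η t y / ‖modifier η t‖ ^ 2) • modifier η t := by
  have hn : ‖modifier η t‖ ^ 2 ≠ 0 := by simpa using h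
  have hmem : kernelSection F y - (modifier η t y / ‖modifier η t‖ ^ 2) • modifier η t ∈
      modifiedSpace η t := by
    rw [mem_modifiedSpace_iff, inner_sub_left, inner_kernelSection_left, real_inner_smul_left,
      real_inner_self_eq_norm_sq, div_mul_cancel₀ _ hn, sub_self]
  have := kernelSection_eq_of_forall_inner (F := modifiedSpace η t) (t := y)
    (g := ⟨_, hmem⟩) (fun f => by
      rw [submodule_coe_apply, Submodule.coe_inner, inner_sub_left, inner_kernelSection_left,
        real_inner_smul_left, real_inner_comm, mem_modifiedSpace_iff.mp f.2, mul_zero, sub_zero])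
  rw [this]

theorem realKernel_modifiedSpace {η : F} {t : X} (h : modifier η t ≠ 0) (x y : X) :
    realKernel (modifiedSpace η t) x y =
      realKernel F x y - modifier η t x * modifier η t y / ‖modifier η t‖ ^ 2 := by
  rw [realKernel_eq, realKernel_eq, submodule_coe_apply, coe_kernelSection_modifiedSpace h,
    RKHS.coe_sub, Pi.sub_apply, RKHS.coe_smul, Pi.smul_apply, smul_eq_mul]
  ring

omit [CompleteSpace F] in
theorem mem_modifiedSpace_self {η : F} {t : X} (hη : ‖η‖ = 1) (ht : η t ≠ 0) :
    η ∈ modifiedSpace η t := by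
  change inner ℝ η η = (η t)⁻¹ * η t
  rw [real_inner_self_eq_norm_sq, hη, inv_mul_cancel₀ ht, one_pow]

omit [CompleteSpace F] in
-- The purpose of the modification: the coefficient along `η` can be read off from a single function
-- value.
theorem eval_eq_inner_of_mem_modifiedSpace {η : F} {t : X} (ht : η t ≠ 0) {f : F}
    (hf : f ∈ modifiedSpace η t) : f t = η t * inner ℝ η f := by
  have : inner ℝ f η = (η t)⁻¹ * f t := hf
  rw [real_inner_comm, this, mul_inv_cancel_left₀ ht]

theorem kernelSection_modifiedSpace_self {η : F} {t : X} (ht : η t ≠ 0)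
    (hmem : η ∈ modifiedSpace η t) :
    kernelSection (modifiedSpace η t) t = η t • (⟨η, hmem⟩ : modifiedSpace η t) :=
  kernelSection_eq_of_forall_inner fun f => by
    rw [submodule_coe_apply, eval_eq_inner_of_mem_modifiedSpace ht f.2, real_inner_smul_left]
    rfl

theorem realKernel_modifiedSpace_self {η : F} {t : X} (ht : η t ≠ 0)
    (hmem : η ∈ modifiedSpace η t) :
    realKernel (modifiedSpace η t) t t = η t * η t := by
  rw [realKernel_eq, kernelSection_modifiedSpace_self ht hmem, RKHS.coe_smul, Pi.smul_apply]
  rfl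

theorem isNormalizedKernelSectionAt_modifiedSpace {η : F} {t : X} (ht : η t ≠ 0)
    (hmem : η ∈ modifiedSpace η t) :
    IsNormalizedKernelSectionAt (⟨η, hmem⟩ : modifiedSpace η t) t ∧
      (0 < η t → (⟨η, hmem⟩ : modifiedSpace η t) =
        (√(realKernel (modifiedSpace η t) t t))⁻¹ • kernelSection (modifiedSpace η t) t) := by
  have key : 0 < η t → (⟨η, hmem⟩ : modifiedSpace η t) =
        (√(realKernel (modifiedSpace η t) t t))⁻¹ • kernelSection (modifiedSpace η t) t := by
    intro h0
    rw [realKernel_modifiedSpace_self ht hmem, Real.sqrt_mul_self_eq_abs,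
      kernelSection_modifiedSpace_self ht hmem, smul_smul, abs_of_pos h0, inv_mul_cancel₀ ht,
      one_smul]
  refine ⟨?_, key⟩
  rcases lt_or_gt_of_ne ht with h0 | h0
  · right
    rw [realKernel_modifiedSpace_self ht hmem, Real.sqrt_mul_self_eq_abs,
      kernelSection_modifiedSpace_self ht hmem, smul_smul, abs_of_neg h0, inv_neg, neg_mul,
      inv_mul_cancel₀ ht, neg_smul, neg_neg, one_smul]
  · exact Or.inl (key h0)

end ModifiedSpace

/-! ### Restriction of an operator to a closed subspace -/

section RestrictOperator

variable {F : Type u} [NormedAddCommGroup F] [InnerProductSpace ℝ F] [CompleteSpace F]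
  {G : Type v} [NormedAddCommGroup G] [InnerProductSpace ℝ G] [CompleteSpace G]

/-- The restricted operator yields the compression of `S* S` to `P`, so eigenvectors of `S* S` lying
in `P` keep their eigenvalue. -/
theorem adjoint_restrict_comp_restrict_apply (S : F →L[ℝ] G) (P : Submodule ℝ F) [CompleteSpace P]
    {x : P} {a : ℝ} (h : S.adjoint (S x) = a • (x : F)) :
    ((S ∘L P.subtypeL).adjoint ∘L (S ∘L P.subtypeL)) x = a • x := by
  refine ext_inner_right ℝ fun y => ?_
  rw [ContinuousLinearMap.comp_apply, ContinuousLinearMap.adjoint_inner_left]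
  change inner ℝ (S x) (S y) = inner ℝ (a • (x : F)) (y : F)
  rw [← h, ContinuousLinearMap.adjoint_inner_left]

theorem orderedEigenvalue_one_restrict {S : F →L[ℝ] G} (hS : IsCompactOperator S)
    (P : Submodule ℝ F) [CompleteSpace P] {η : F} (hη : ‖η‖ = 1) (hP : η ∈ P)
    (h : S.adjoint (S η) = orderedEigenvalue (S.adjoint ∘L S) 1 • η) :
    orderedEigenvalue ((S ∘L P.subtypeL).adjoint ∘L (S ∘L P.subtypeL)) 1 =
      orderedEigenvalue (S.adjoint ∘L S) 1 := by
  refine le_antisymm (orderedEigenvalue_restrict_le hS P le_rfl) ?_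
  have hpos := ContinuousLinearMap.isPositive_adjoint_comp_self (S ∘L P.subtypeL)
  refine le_orderedEigenvalue hpos.isSymmetric le_rfl ?_
  have hmem := mem_upperEigenspace le_rfl
    (adjoint_restrict_comp_restrict_apply S P (x := ⟨η, hP⟩) h)
  rw [Nat.cast_one, Cardinal.one_le_iff_pos, rank_pos_iff_exists_ne_zero]
  refine ⟨⟨_, hmem⟩, fun h0 => ?_⟩
  have : η = 0 := congrArg (fun z : upperEigenspace _ _ => ((z : P) : F)) h0
  rw [this, norm_zero] at hη
  exact zero_ne_one hη

end RestrictOperator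

/-! ### Minimal errors and their decay under restriction -/

section MinimalError

variable {X : Type w} {F : Type u} [NormedAddCommGroup F] [InnerProductSpace ℝ F]
  {G : Type v} [NormedAddCommGroup G] [InnerProductSpace ℝ G]

theorem minimalError_nonneg (Λ : Set (F →L[ℝ] ℝ)) (S : F →L[ℝ] G) (n : ℕ) :
    0 ≤ minimalError Λ S n := by
  apply Real.sInf_nonneg
  rintro _ ⟨A, _, rfl⟩
  exact norm_nonneg _

theorem minimalError_le {Λ : Set (F →L[ℝ] ℝ)} {S : F →L[ℝ] G} {n : ℕ} {A : F →L[ℝ] G}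
    (hA : A ∈ algorithms Λ S n) : minimalError Λ S n ≤ ‖S - A‖ :=
  csInf_le ⟨0, by rintro _ ⟨A, _, rfl⟩; exact norm_nonneg _⟩ ⟨A, hA, rfl⟩

theorem algorithms_nonempty {Λ : Set (F →L[ℝ] ℝ)} (hΛ : Λ.Nonempty) (S : F →L[ℝ] G) (n : ℕ) :
    (algorithms Λ S n).Nonempty := by
  obtain ⟨L, hL⟩ := hΛ
  exact ⟨_, fun _ => L, fun _ => 0, fun _ => hL, fun _ => ⟨0, map_zero S⟩, rfl⟩

theorem exists_algorithm_norm_lt {Λ : Set (F →L[ℝ] ℝ)} (hΛ : Λ.Nonempty) {S : F →L[ℝ] G} {n : ℕ}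
    {e : ℝ} (he : minimalError Λ S n < e) : ∃ A ∈ algorithms Λ S n, ‖S - A‖ < e := by
  obtain ⟨_, ⟨A, hA, rfl⟩, h⟩ := exists_lt_of_csInf_lt ((algorithms_nonempty hΛ S n).image _) he
  exact ⟨A, hA, h⟩

/-- Restricting an operator to a subspace does not increase the minimal errors: the outputs of an
algorithm may be projected to the closure of the range of the restriction. -/
theorem minimalError_restrict_le [CompleteSpace G] {Λ : Set (F →L[ℝ] ℝ)} (hΛ : Λ.Nonempty)
    (S : F →L[ℝ] G) (P : Submodule ℝ F) {Λ' : Set (P →L[ℝ] ℝ)}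
    (hΛ' : ∀ L ∈ Λ, L ∘L P.subtypeL ∈ Λ') (n : ℕ) :
    minimalError Λ' (S ∘L P.subtypeL) n ≤ minimalError Λ S n := by
  refine le_csInf ((algorithms_nonempty hΛ S n).image _) ?_
  rintro _ ⟨_, ⟨L, g, hL, -, rfl⟩, rfl⟩
  set S' := S ∘L P.subtypeL with hS'
  set A := ∑ j, (L j).smulRight (g j) with hA
  set R : Submodule ℝ G := (LinearMap.range (S' : P →ₗ[ℝ] G)).topologicalClosure with hR
  have hSR : ∀ x, R.starProjection (S' x) = S' x := fun x =>
    Submodule.starProjection_eq_self_iff.mpr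
      (Submodule.le_topologicalClosure _ (LinearMap.mem_range_self (S' : P →ₗ[ℝ] G) x))
  set M := ∑ j, ‖L j‖ with hM
  have hM0 : 0 ≤ M := Finset.sum_nonneg fun j _ => norm_nonneg _
  refine le_of_forall_pos_le_add fun δ hδ => ?_
  -- Outputs must lie in the range of `S'`, while the projected `g j` lie only in its closure; they
  -- are replaced by elements of the range at total cost `δ`. The `+ 1` covers the case that all `L
  -- j` vanish.
  have hδ' : 0 < δ / (M + 1) := by positivity
  have happrox : ∀ j, ∃ x : P, ‖R.starProjection (g j) - S' x‖ < δ / (M + 1) := by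
    intro j
    have hmem : R.starProjection (g j) ∈ closure (Set.range S') := by
      have : R.starProjection (g j) ∈ R := Submodule.starProjection_apply_mem _ _
      have hcl : (R : Set G) = closure (Set.range S') := Submodule.topologicalClosure_coe _
      rw [← hcl]
      exact this
    obtain ⟨_, ⟨x, rfl⟩, hx⟩ := Metric.mem_closure_iff.mp hmem _ hδ'
    exact ⟨x, by rwa [dist_eq_norm] at hx⟩
  choose x hx using happrox
  refine (minimalError_le (A := ∑ j, (L j ∘L P.subtypeL).smulRight (S' (x j)))
    ⟨_, _, fun j => hΛ' _ (hL j), fun j => ⟨x j, rfl⟩, rfl⟩).trans ?_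
  refine ContinuousLinearMap.opNorm_le_bound _ (by positivity) fun p => ?_
  have hdecomp : (S' - ∑ j, (L j ∘L P.subtypeL).smulRight (S' (x j))) p =
      R.starProjection ((S - A) p) + ∑ j, L j p • (R.starProjection (g j) - S' (x j)) := by
    have h1 : R.starProjection (S p) = S' p := hSR p
    simp only [hA, sub_apply, sum_apply,
      ContinuousLinearMap.smulRight_apply, map_sub, map_sum, map_smul, h1, smul_sub,
      Finset.sum_sub_distrib]
    simp
  rw [hdecomp, add_mul]
  refine (norm_add_le _ _).trans (add_le_add ?_ ?_)
  · exact (R.norm_starProjection_apply_le _).trans ((S - A).le_opNorm p)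
  · calc ‖∑ j, L j p • (R.starProjection (g j) - S' (x j))‖
        ≤ ∑ j, (‖L j‖ * ‖p‖) * (δ / (M + 1)) := by
          refine norm_sum_le_of_le _ fun j _ => ?_
          rw [norm_smul]
          exact mul_le_mul ((L j).le_opNorm p) (hx j).le (norm_nonneg _) (by positivity)
      _ = (M / (M + 1)) * δ * ‖p‖ := by
          rw [← Finset.sum_mul, ← Finset.sum_mul, ← hM]; field_simp
      _ ≤ 1 * δ * ‖p‖ := by
          gcongr
          rw [div_le_one (by positivity)]; linarith
      _ = δ * ‖p‖ := by ring

theorem decay_pos_iff {a : ℕ → ℝ} : 0 < decay a ↔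
    ∃ r : ℝ, 0 < r ∧ Tendsto (fun n : ℕ => (n : ℝ) ^ r * a n) atTop (𝓝 0) := by
  simp only [decay, lt_iSup_iff]
  constructor
  · rintro ⟨r, hr, h0⟩
    exact ⟨r, by exact_mod_cast h0, hr⟩
  · rintro ⟨r, h0, hr⟩
    exact ⟨⟨r, h0.le⟩, hr, ENNReal.coe_pos.mpr h0⟩

theorem decay_pos_of_le {a b : ℕ → ℝ} (ha : 0 < decay a) (h0 : ∀ n, 0 ≤ b n)
    (hab : ∀ n, b n ≤ a n) : 0 < decay b := by
  rw [decay_pos_iff] at ha ⊢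
  obtain ⟨r, hr, h⟩ := ha
  refine ⟨r, hr, squeeze_zero (fun n => mul_nonneg (by positivity) (h0 n)) (fun n => ?_) h⟩
  exact mul_le_mul_of_nonneg_left (hab n) (by positivity)

theorem minimalError_stdInfo_restrict_le [CompleteSpace G] [CompleteSpace F] [RKHS ℝ F X ℝ]
    [Nonempty X] (S : F →L[ℝ] G) (P : Submodule ℝ F) (n : ℕ) :
    minimalError (stdInfo P) (S ∘L P.subtypeL) n ≤ minimalError (stdInfo F) S n := by
  refine minimalError_restrict_le (Set.range_nonempty _) S P ?_ n
  rintro _ ⟨t, rfl⟩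
  exact ⟨t, rfl⟩

end MinimalError

/-! ### Combining algorithms -/

section Algorithms

variable {F : Type u} [NormedAddCommGroup F] [InnerProductSpace ℝ F]
  {G : Type v} [NormedAddCommGroup G] [InnerProductSpace ℝ G]
  {Λ : Set (F →L[ℝ] ℝ)} {S : F →L[ℝ] G}

theorem algorithms_zero_mem : (0 : F →L[ℝ] G) ∈ algorithms Λ S 0 :=
  ⟨Fin.elim0, Fin.elim0, fun j => j.elim0, fun j => j.elim0, by simp⟩

theorem algorithms_add {n m : ℕ} {A B : F →L[ℝ] G} (hA : A ∈ algorithms Λ S n)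
    (hB : B ∈ algorithms Λ S m) : A + B ∈ algorithms Λ S (n + m) := by
  obtain ⟨L, g, hL, hg, rfl⟩ := hA
  obtain ⟨L', g', hL', hg', rfl⟩ := hB
  refine ⟨Fin.append L L', Fin.append g g', fun j => ?_, fun j => ?_, ?_⟩
  · refine Fin.addCases (fun i => ?_) (fun i => ?_) j
    · rw [Fin.append_left]; exact hL i
    · rw [Fin.append_right]; exact hL' i
  · refine Fin.addCases (fun i => ?_) (fun i => ?_) j
    · rw [Fin.append_left]; exact hg i
    · rw [Fin.append_right]; exact hg' i
  · rw [Fin.sum_univ_add]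
    simp only [Fin.append_left, Fin.append_right]

theorem algorithms_single {L : F →L[ℝ] ℝ} (hL : L ∈ Λ) {g : G} (hg : g ∈ Set.range S) :
    L.smulRight g ∈ algorithms Λ S 1 :=
  ⟨fun _ => L, fun _ => g, fun _ => hL, fun _ => hg, by simp⟩

theorem algorithms_neg {n : ℕ} {A : F →L[ℝ] G} (hA : A ∈ algorithms Λ S n) :
    -A ∈ algorithms Λ S n := by
  obtain ⟨L, g, hL, hg, rfl⟩ := hA
  refine ⟨L, fun j => -g j, hL, fun j => ?_, ?_⟩
  · obtain ⟨x, hx⟩ := hg j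
    exact ⟨-x, by rw [map_neg, hx]⟩
  · ext x
    simp

theorem algorithms_sum {ι : Type*} (s : Finset ι) {n : ι → ℕ} {A : ι → F →L[ℝ] G}
    (h : ∀ i ∈ s, A i ∈ algorithms Λ S (n i)) :
    ∑ i ∈ s, A i ∈ algorithms Λ S (∑ i ∈ s, n i) := by
  classical
  induction s using Finset.induction_on with
  | empty => simpa using algorithms_zero_mem
  | insert a s ha ih =>
    rw [Finset.sum_insert ha, Finset.sum_insert ha]
    exact algorithms_add (h a (Finset.mem_insert_self a s))
      (ih fun i hi => h i (Finset.mem_insert_of_mem hi))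

theorem algorithms_mono_info {Λ' : Set (F →L[ℝ] ℝ)} (h : Λ ⊆ Λ') {n : ℕ} :
    algorithms Λ S n ⊆ algorithms Λ' S n := by
  rintro A ⟨L, g, hL, hg, rfl⟩
  exact ⟨L, g, fun j => h (hL j), hg, rfl⟩

end Algorithms

/-! ### Operators on tensor products -/

section Tensor

variable {E : Type*} [NormedAddCommGroup E] [InnerProductSpace ℝ E]
  {H : Type*} [NormedAddCommGroup H] [InnerProductSpace ℝ H]
  {F : Type*} [NormedAddCommGroup F] [InnerProductSpace ℝ F]
  {G : Type*} [NormedAddCommGroup G] [InnerProductSpace ℝ G]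

theorem tensor_clm_ext {K : Type*} [AddCommGroup K] [Module ℝ K] [TopologicalSpace K]
    {A B : E ⊗[ℝ] F →L[ℝ] K}
    (h : ∀ x y, A (x ⊗ₜ y) = B (x ⊗ₜ y)) : A = B := by
  have h3 : A.toLinearMap = B.toLinearMap := TensorProduct.ext' fun x y => h x y
  ext a
  exact DFunLike.congr_fun h3 a

theorem mapL_sub_left (A B : E →L[ℝ] H) (C : F →L[ℝ] G) :
    TensorProduct.mapL (A - B) C = TensorProduct.mapL A C - TensorProduct.mapL B C :=
  tensor_clm_ext fun x y => by simp [TensorProduct.sub_tmul]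

theorem mapL_sum_right {ι : Type*} (s : Finset ι) (A : E →L[ℝ] H) (B : ι → F →L[ℝ] G) :
    TensorProduct.mapL A (∑ i ∈ s, B i) = ∑ i ∈ s, TensorProduct.mapL A (B i) :=
  tensor_clm_ext fun x y => by simp [TensorProduct.tmul_sum]

/-- Orthogonality in one factor suffices, because inner products of elementary tensors are products
and both arguments extend by additivity. -/
theorem inner_mapL_mapL_eq_zero {E' F' : Type*} [NormedAddCommGroup E'] [InnerProductSpace ℝ E']
    [NormedAddCommGroup F'] [InnerProductSpace ℝ F']
    (A : E →L[ℝ] H) (A' : E' →L[ℝ] H) (B : F →L[ℝ] G) (B' : F' →L[ℝ] G)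
    (h : ∀ x y, inner ℝ (B x) (B' y) = 0) (z : E ⊗[ℝ] F) (z' : E' ⊗[ℝ] F') :
    inner ℝ (TensorProduct.mapL A B z) (TensorProduct.mapL A' B' z') = 0 := by
  induction z with
  | zero => rw [map_zero, inner_zero_left]
  | add a b ha hb => rw [map_add, inner_add_left, ha, hb, add_zero]
  | tmul a b =>
    induction z' with
    | zero => rw [map_zero, inner_zero_right]
    | add c d hc hd => rw [map_add, inner_add_right, hc, hd, add_zero]
    | tmul c d =>
      rw [TensorProduct.mapL_tmul, TensorProduct.mapL_tmul, TensorProduct.inner_tmul, h, mul_zero]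

/-- The sum of two operators with orthogonal ranges that factor through complementary orthogonal
projections is bounded by the maximum of the norms. -/
theorem opNorm_add_le_of_orthogonal (A B : E →L[ℝ] H) (p p' : E →L[ℝ] E)
    (hadd : ∀ z, p z + p' z = z) (hp : ∀ z, inner ℝ (p z) (p' z) = 0)
    (hA : ∀ z, A (p z) = A z) (hB : ∀ z, B (p' z) = B z)
    (hAB : ∀ z, inner ℝ (A z) (B z) = 0) {c : ℝ} (hAc : ‖A‖ ≤ c) (hBc : ‖B‖ ≤ c) :
    ‖A + B‖ ≤ c := by
  have hc : 0 ≤ c := (norm_nonneg _).trans hAc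
  refine ContinuousLinearMap.opNorm_le_bound _ hc fun z => ?_
  refine le_of_sq_le_sq ?_ (by positivity)
  have h1 : ‖(A + B) z‖ ^ 2 = ‖A z‖ ^ 2 + ‖B z‖ ^ 2 := by
    rw [add_apply]
    simpa only [← sq] using norm_add_sq_eq_norm_sq_add_norm_sq_real (hAB z)
  have h2 : ‖z‖ ^ 2 = ‖p z‖ ^ 2 + ‖p' z‖ ^ 2 := by
    conv_lhs => rw [← hadd z]
    simpa only [← sq] using norm_add_sq_eq_norm_sq_add_norm_sq_real (hp z)
  have h3 : ‖A z‖ ≤ c * ‖p z‖ := by rw [← hA]; exact A.le_of_opNorm_le hAc _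
  have h4 : ‖B z‖ ≤ c * ‖p' z‖ := by rw [← hB]; exact B.le_of_opNorm_le hBc _
  calc ‖(A + B) z‖ ^ 2 = ‖A z‖ ^ 2 + ‖B z‖ ^ 2 := h1
    _ ≤ (c * ‖p z‖) ^ 2 + (c * ‖p' z‖) ^ 2 := by gcongr
    _ = (c * ‖z‖) ^ 2 := by rw [mul_pow, mul_pow, mul_pow, h2]; ring

/-- The functionals `L ⊗ L'` with `L ∈ Λ` and `L' ∈ Λ'`. -/
def tensorInfo (Λ : Set (E →L[ℝ] ℝ)) (Λ' : Set (F →L[ℝ] ℝ)) : Set (E ⊗[ℝ] F →L[ℝ] ℝ) :=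
  {φ | ∃ L ∈ Λ, ∃ L' ∈ Λ', ∀ x y, φ (x ⊗ₜ y) = L x * L' y}

/-- Expanding both sums gives `n * m` product functionals with product outputs; the pairs are
renumbered by `finProdFinEquiv`. -/
theorem algorithms_mapL {Λ : Set (E →L[ℝ] ℝ)} {Λ' : Set (F →L[ℝ] ℝ)} {S : E →L[ℝ] H}
    {T : F →L[ℝ] G} {n m : ℕ} {A : E →L[ℝ] H} {B : F →L[ℝ] G} (hA : A ∈ algorithms Λ S n)
    (hB : B ∈ algorithms Λ' T m) :
    TensorProduct.mapL A B ∈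
      algorithms (tensorInfo Λ Λ') (TensorProduct.mapL S T) (n * m) := by
  obtain ⟨L, g, hL, hg, rfl⟩ := hA
  obtain ⟨L', g', hL', hg', rfl⟩ := hB
  let φ : Fin n × Fin m → (E ⊗[ℝ] F →L[ℝ] ℝ) := fun i =>
    (TensorProduct.lidIsometry ℝ ℝ).toContinuousLinearEquiv.toContinuousLinearMap ∘L
      TensorProduct.mapL (L i.1) (L' i.2)
  have hφ : ∀ i x y, φ i (x ⊗ₜ y) = L i.1 x * L' i.2 y := fun i x y => by
    change TensorProduct.lid ℝ ℝ (TensorProduct.mapL (L i.1) (L' i.2) (x ⊗ₜ y)) = _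
    rw [TensorProduct.mapL_tmul, TensorProduct.lid_tmul, smul_eq_mul]
  refine ⟨fun j => φ (finProdFinEquiv.symm j),
    fun j => g (finProdFinEquiv.symm j).1 ⊗ₜ g' (finProdFinEquiv.symm j).2,
    fun j => ⟨_, hL _, _, hL' _, hφ _⟩, fun j => ?_, ?_⟩
  · obtain ⟨x, hx⟩ := hg (finProdFinEquiv.symm j).1
    obtain ⟨y, hy⟩ := hg' (finProdFinEquiv.symm j).2
    exact ⟨x ⊗ₜ y, by rw [TensorProduct.mapL_tmul, hx, hy]⟩
  · rw [finProdFinEquiv.symm.sum_comp (fun i => (φ i).smulRight (g i.1 ⊗ₜ[ℝ] g' i.2))]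
    refine tensor_clm_ext fun x y => ?_
    rw [TensorProduct.mapL_tmul]
    simp only [sum_apply, ContinuousLinearMap.smulRight_apply, hφ,
      TensorProduct.sum_tmul, TensorProduct.tmul_sum, TensorProduct.smul_tmul_smul]
    rw [Fintype.sum_prod_type, Finset.sum_comm]

end Tensor

/-! ### Multilevel algorithms for tensor products -/

section Multilevel

variable {E : Type*} [NormedAddCommGroup E] [InnerProductSpace ℝ E]
  {H : Type*} [NormedAddCommGroup H] [InnerProductSpace ℝ H]
  {F : Type*} [NormedAddCommGroup F] [InnerProductSpace ℝ F]
  {G : Type*} [NormedAddCommGroup G] [InnerProductSpace ℝ G]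

theorem opNorm_sum_le {ι : Type*} (s : Finset ι) (A : ι → E →L[ℝ] H) :
    ‖∑ i ∈ s, A i‖ ≤ ∑ i ∈ s, ‖A i‖ :=
  norm_sum_le s A

/-- The part `f ↦ ⟪η, f⟫ S η` of the operator `S`. -/
noncomputable def leadingPart (S : F →L[ℝ] G) (η : F) : F →L[ℝ] G := (innerSL ℝ η).smulRight (S η)

theorem leadingPart_apply (S : F →L[ℝ] G) (η f : F) :
    leadingPart S η f = (inner ℝ η f : ℝ) • S η := rfl

/-- The operator `B` vanishes at `η` and its range is orthogonal to `S η`. -/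
def IsOffLeading (S : F →L[ℝ] G) (η : F) (B : F →L[ℝ] G) : Prop :=
  B η = 0 ∧ ∀ f, inner ℝ (S η) (B f) = 0

theorem IsOffLeading.sub {S : F →L[ℝ] G} {η : F} {B C : F →L[ℝ] G} (hB : IsOffLeading S η B)
    (hC : IsOffLeading S η C) : IsOffLeading S η (B - C) :=
  ⟨by simp [hB.1, hC.1], fun f => by rw [sub_apply, inner_sub_right, hB.2, hC.2, sub_zero]⟩

theorem IsOffLeading.sum {ι : Type*} {s : Finset ι} {S : F →L[ℝ] G} {η : F} {B : ι → F →L[ℝ] G}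
    (hB : ∀ i, IsOffLeading S η (B i)) : IsOffLeading S η (∑ i ∈ s, B i) :=
  ⟨by simp [fun i => (hB i).1], fun f => by
    rw [sum_apply, inner_sum]; exact Finset.sum_eq_zero fun i _ => (hB i).2 f⟩

theorem isOffLeading_sub_leadingPart {S : F →L[ℝ] G} {η : F} (hη : ‖η‖ = 1)
    (horth : ∀ v, inner ℝ (S η) (S v) = ‖S η‖ ^ 2 * inner ℝ η v) :
    IsOffLeading S η (S - leadingPart S η) := by
  refine ⟨?_, fun f => ?_⟩
  · rw [sub_apply, leadingPart_apply, real_inner_self_eq_norm_sq, hη]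
    simp
  · rw [sub_apply, leadingPart_apply, inner_sub_right, horth, real_inner_smul_right,
      real_inner_self_eq_norm_sq]
    ring

/-- The operator `S` is the sum of its leading part and of operators `Δ l` which use `m l`
functionals and have small norms, even when weighted with `a l`. -/
structure IsMultilevel (Λ : Set (F →L[ℝ] ℝ)) (S : F →L[ℝ] G) (η : F) (Δ : ℕ → F →L[ℝ] G)
    (m : ℕ → ℕ) (a : ℕ → ℝ) (τ : ℝ) : Prop where
  weight_pos : ∀ l, 0 < a l
  leadingPart_mem : leadingPart S η ∈ algorithms Λ S 1
  mem : ∀ l, Δ l ∈ algorithms Λ S (m l)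
  reduced : ∀ l, IsOffLeading S η (Δ l)
  sum_le : ∀ L, ∑ l ∈ Finset.range L, a l * ‖Δ l‖ ≤ τ
  tendsto : Tendsto (fun L => ‖S - leadingPart S η - ∑ l ∈ Finset.range L, Δ l‖) atTop (𝓝 0)

theorem IsOffLeading.apply_sub {S : F →L[ℝ] G} {η : F} {B : F →L[ℝ] G} (hB : IsOffLeading S η B)
    (f : F) : B (f - (inner ℝ η f : ℝ) • η) = B f := by
  rw [map_sub, map_smul, hB.1, smul_zero, sub_zero]

/-- The first term depends only on the component in `E ⊗ η` and maps into `H ⊗ S η`; the others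
depend only on `E ⊗ ηᗮ` and map into `H ⊗ (S η)ᗮ`. So the norm is controlled by a maximum instead of
a sum, and errors do not accumulate from factor to factor. -/
theorem norm_mapL_leadingPart_add_sum_le {S : F →L[ℝ] G} {η : F} (hη : ‖η‖ = 1)
    {ι : Type*} (s : Finset ι) (A : E →L[ℝ] H) (A' : ι → E →L[ℝ] H)
    (B : ι → F →L[ℝ] G) (hB : ∀ i, IsOffLeading S η (B i)) {c : ℝ}
    (h1 : ‖A‖ * ‖S η‖ ≤ c) (h2 : ‖∑ i ∈ s, TensorProduct.mapL (A' i) (B i)‖ ≤ c) :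
    ‖TensorProduct.mapL A (leadingPart S η) + ∑ i ∈ s, TensorProduct.mapL (A' i) (B i)‖ ≤ c := by
  let q : F →L[ℝ] F := (innerSL ℝ η).smulRight η
  let q' : F →L[ℝ] F := ContinuousLinearMap.id ℝ F - q
  have hq : ∀ f, q f = (inner ℝ η f : ℝ) • η := fun f => rfl
  have hq' : ∀ f, q' f = f - (inner ℝ η f : ℝ) • η := fun f => rfl
  let I : E →L[ℝ] E := ContinuousLinearMap.id ℝ E
  have hηη : inner ℝ η η = (1 : ℝ) := by rw [real_inner_self_eq_norm_sq, hη, one_pow]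
  have hlead : ∀ f, leadingPart S η (q f) = leadingPart S η f := fun f => by
    rw [leadingPart_apply, leadingPart_apply, hq, real_inner_smul_right, hηη, mul_one]
  refine opNorm_add_le_of_orthogonal _ _ (TensorProduct.mapL I q) (TensorProduct.mapL I q')
    (fun z => ?_) (fun z => inner_mapL_mapL_eq_zero _ _ _ _ (fun x y => ?_) z z) (fun z => ?_)
    (fun z => ?_) (fun z => ?_) ?_ h2
  · rw [← add_apply, ← TensorProduct.mapL_add_right]
    have : q + q' = ContinuousLinearMap.id ℝ F := add_sub_cancel _ _
    rw [this, TensorProduct.mapL_id_id, ContinuousLinearMap.id_apply]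
  · rw [hq, hq', real_inner_smul_left, inner_sub_right, real_inner_smul_right, hηη]
    ring
  · rw [← ContinuousLinearMap.comp_apply]
    congr 1
    exact tensor_clm_ext fun x y => by
      rw [ContinuousLinearMap.comp_apply, TensorProduct.mapL_tmul, TensorProduct.mapL_tmul,
        TensorProduct.mapL_tmul, hlead]
      rfl
  · rw [← ContinuousLinearMap.comp_apply]
    congr 1
    exact tensor_clm_ext fun x y => by
      rw [ContinuousLinearMap.comp_apply, TensorProduct.mapL_tmul, sum_apply, sum_apply]
      refine Finset.sum_congr rfl fun i _ => ?_
      rw [TensorProduct.mapL_tmul, TensorProduct.mapL_tmul, hq', (hB i).apply_sub]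
      rfl
  · rw [sum_apply, inner_sum]
    refine Finset.sum_eq_zero fun i _ => inner_mapL_mapL_eq_zero _ _ _ _ (fun x y => ?_) z z
    rw [leadingPart_apply, real_inner_smul_left, (hB i).2, mul_zero]
  · refine (TensorProduct.norm_mapL_le _ _).trans (le_trans ?_ h1)
    refine mul_le_mul_of_nonneg_left ?_ (norm_nonneg _)
    rw [leadingPart, ContinuousLinearMap.norm_smulRight_apply, innerSL_apply_norm, hη, one_mul]

/-- A level of small norm tolerates a crude approximation of `T`, so `Δ l` is paired with accuracy
`a l * ε`. The off-leading error is at most `c ε (‖S η‖ - τ)` from the tail plus `c ε τ` from the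
levels, the same bound `c ε ‖S η‖` as for the leading error. -/
theorem exists_algorithm_mapL {Λ : Set (E →L[ℝ] ℝ)} {Λ' : Set (F →L[ℝ] ℝ)} {T : E →L[ℝ] H}
    {S : F →L[ℝ] G} {η : F} (hη : ‖η‖ = 1)
    (horth : ∀ v, inner ℝ (S η) (S v) = ‖S η‖ ^ 2 * inner ℝ η v)
    {Δ : ℕ → F →L[ℝ] G} {m : ℕ → ℕ} {a : ℕ → ℝ} {τ : ℝ} (hΔ : IsMultilevel Λ' S η Δ m a τ)
    (hτ : τ < ‖S η‖) {p b : ℝ} (hb : ∀ L, ∑ l ∈ Finset.range L, m l * a l ^ (-p) ≤ b)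
    {c M : ℝ} (hT : ‖T‖ ≤ c) (hM : 0 ≤ M)
    (ih : ∀ ε : ℝ, 0 < ε → ∃ n, ∃ A ∈ algorithms Λ T n, (n : ℝ) ≤ M * ε ^ (-p) ∧ ‖T - A‖ ≤ ε * c)
    {ε : ℝ} (hε : 0 < ε) :
    ∃ n, ∃ A ∈ algorithms (tensorInfo Λ Λ') (TensorProduct.mapL T S) n,
      (n : ℝ) ≤ (1 + b) * M * ε ^ (-p) ∧ ‖TensorProduct.mapL T S - A‖ ≤ ε * (c * ‖S η‖) := by
  have hc : 0 ≤ c := (norm_nonneg T).trans hT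
  set R : ℕ → F →L[ℝ] G := fun L => S - leadingPart S η - ∑ l ∈ Finset.range L, Δ l with hR
  -- The truncation level is chosen so that the tail uses exactly the share of the error budget left
  -- over by `τ`.
  obtain ⟨L, hL⟩ : ∃ L, ‖R L‖ ≤ ε * (‖S η‖ - τ) :=
    ((hΔ.tendsto.eventually_le_const (mul_pos hε (sub_pos.mpr hτ)))).exists
  obtain ⟨n₀, A₀, hA₀, hn₀, hTA₀⟩ := ih ε hε
  choose n A hA hn hTA using fun l => ih (a l * ε) (mul_pos (hΔ.weight_pos l) hε)
  refine ⟨n₀ * 1 + ∑ l ∈ Finset.range L, n l * m l,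
    TensorProduct.mapL A₀ (leadingPart S η) +
      ∑ l ∈ Finset.range L, TensorProduct.mapL (A l) (Δ l),
    algorithms_add (algorithms_mapL hA₀ hΔ.leadingPart_mem)
      (algorithms_sum _ fun l _ => algorithms_mapL (hA l) (hΔ.mem l)), ?_, ?_⟩
  · push_cast
    have h1 : ∑ l ∈ Finset.range L, (n l : ℝ) * m l ≤
        (M * ε ^ (-p)) * ∑ l ∈ Finset.range L, m l * a l ^ (-p) := by
      rw [Finset.mul_sum]
      refine Finset.sum_le_sum fun l _ => ?_
      calc (n l : ℝ) * m l ≤ (M * (a l * ε) ^ (-p)) * m l := by gcongr; exact hn l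
        _ = _ := by rw [Real.mul_rpow (hΔ.weight_pos l).le hε.le]; ring
    have h2 : (M * ε ^ (-p)) * ∑ l ∈ Finset.range L, m l * a l ^ (-p) ≤ (M * ε ^ (-p)) * b := by
      gcongr
      exact hb L
    linarith
  -- The index `none` carries the tail, where `T` is not approximated at all; tail and levels then
  -- form one off-leading family.
  · let A' : Option ℕ → E →L[ℝ] H := fun o => o.elim T (fun l => T - A l)
    let B : Option ℕ → F →L[ℝ] G := fun o => o.elim (R L) Δ
    have hred : IsOffLeading S η (R L) :=
      (isOffLeading_sub_leadingPart hη horth).sub (IsOffLeading.sum hΔ.reduced)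
    have hB : ∀ o, IsOffLeading S η (B o) := by
      rintro (_ | l)
      · exact hred
      · exact hΔ.reduced l
    have hsum : ∑ o ∈ Finset.insertNone (Finset.range L), TensorProduct.mapL (A' o) (B o) =
        TensorProduct.mapL T (R L) + ∑ l ∈ Finset.range L, TensorProduct.mapL (T - A l) (Δ l) := by
      rw [Finset.sum_insertNone]
      rfl
    have hS : S = leadingPart S η + (R L + ∑ l ∈ Finset.range L, Δ l) := by
      simp only [hR, sub_add_cancel, add_sub_cancel]
    have hdecomp : TensorProduct.mapL T S - (TensorProduct.mapL A₀ (leadingPart S η) +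
        ∑ l ∈ Finset.range L, TensorProduct.mapL (A l) (Δ l)) =
        TensorProduct.mapL (T - A₀) (leadingPart S η) +
        ∑ o ∈ Finset.insertNone (Finset.range L), TensorProduct.mapL (A' o) (B o) := by
      have hTS : TensorProduct.mapL T S = TensorProduct.mapL T (leadingPart S η) +
          (TensorProduct.mapL T (R L) + ∑ l ∈ Finset.range L, TensorProduct.mapL T (Δ l)) := by
        rw [← mapL_sum_right, ← TensorProduct.mapL_add_right, ← TensorProduct.mapL_add_right, ← hS]
      rw [hsum, hTS]
      simp only [mapL_sub_left, Finset.sum_sub_distrib]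
      abel
    rw [hdecomp]
    refine norm_mapL_leadingPart_add_sum_le hη _ _ _ _ hB ?_ ?_
    · rw [← mul_assoc]
      gcongr
    · rw [hsum]
      have h3 : ‖∑ l ∈ Finset.range L, TensorProduct.mapL (T - A l) (Δ l)‖ ≤
          ∑ l ∈ Finset.range L, ‖TensorProduct.mapL (T - A l) (Δ l)‖ :=
        opNorm_sum_le _ _
      refine (ContinuousLinearMap.opNorm_add_le _ _).trans ((add_le_add le_rfl h3).trans ?_)
      calc ‖TensorProduct.mapL T (R L)‖ +
            ∑ l ∈ Finset.range L, ‖TensorProduct.mapL (T - A l) (Δ l)‖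
          ≤ c * (ε * (‖S η‖ - τ)) + ∑ l ∈ Finset.range L, (ε * c) * (a l * ‖Δ l‖) := by
            refine add_le_add ?_ (Finset.sum_le_sum fun l _ => ?_)
            · exact (TensorProduct.norm_mapL_le _ _).trans (by gcongr)
            · refine (TensorProduct.norm_mapL_le _ _).trans ?_
              calc ‖T - A l‖ * ‖Δ l‖ ≤ (a l * ε * c) * ‖Δ l‖ := by gcongr; exact hTA l
                _ = _ := by ring
        _ ≤ c * (ε * (‖S η‖ - τ)) + (ε * c) * τ := by
            rw [← Finset.mul_sum]
            gcongr
            exact hΔ.sum_le L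
        _ = _ := by ring

end Multilevel

/-! ### Tensor powers -/

section TensorPowers

variable {X : Type w} {F : Type u} [NormedAddCommGroup F] [InnerProductSpace ℝ F]
  {G : Type v} [NormedAddCommGroup G] [InnerProductSpace ℝ G]

theorem norm_algPureTensor (d : ℕ) (f : Fin d → F) : ‖algPureTensor d f‖ = ∏ i, ‖f i‖ := by
  induction d with
  | zero =>
    change ‖(ULift.up (1 : ℝ) : ULift.{u} ℝ)‖ = _
    simp
  | succ d ih =>
    change ‖(algPureTensor d (fun i => f i.castSucc) ⊗ₜ[ℝ] f (Fin.last d) :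
        (algTensorPow F d).carrier ⊗[ℝ] F)‖ = _
    rw [TensorProduct.norm_tmul, ih, Fin.prod_univ_castSucc]

theorem algTensorMap_algPureTensor (S : F →L[ℝ] G) (d : ℕ) (f : Fin d → F) :
    algTensorMap S d (algPureTensor d f) = algPureTensor d fun i => S (f i) := by
  induction d with
  | zero => rfl
  | succ d ih =>
    change (TensorProduct.mapL (algTensorMap S d) S)
      (algPureTensor d (fun i => f i.castSucc) ⊗ₜ[ℝ] f (Fin.last d)) =
      (algPureTensor d (fun i => S (f i.castSucc)) ⊗ₜ[ℝ] S (f (Fin.last d)))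
    rw [TensorProduct.mapL_tmul, ih]

theorem norm_algTensorMap_le (S : F →L[ℝ] G) (d : ℕ) : ‖algTensorMap S d‖ ≤ ‖S‖ ^ d := by
  induction d with
  | zero =>
    rw [pow_zero]
    refine ContinuousLinearMap.opNorm_le_bound _ zero_le_one fun x => ?_
    rw [one_mul]
    exact le_rfl
  | succ d ih =>
    change ‖TensorProduct.mapL (algTensorMap S d) S‖ ≤ _
    refine (TensorProduct.norm_mapL_le _ _).trans ?_
    rw [pow_succ]
    gcongr

theorem tensorPowMap_algTensorIncl (S : F →L[ℝ] G) (d : ℕ) (a : (algTensorPow F d).carrier) :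
    tensorPowMap S d (algTensorIncl F d a) = algTensorIncl G d (algTensorMap S d a) :=
  ContinuousLinearMap.extend_eq _ UniformSpace.Completion.denseRange_coe
    (UniformSpace.Completion.isUniformInducing_coe _) a

theorem norm_algTensorIncl (d : ℕ) (a : (algTensorPow F d).carrier) :
    ‖algTensorIncl F d a‖ = ‖a‖ :=
  UniformSpace.Completion.norm_coe a

theorem denseRange_algTensorIncl (d : ℕ) : DenseRange (algTensorIncl F d) :=
  UniformSpace.Completion.denseRange_coe (α := (algTensorPow F d).carrier)

/-- Test on `η ⊗ ⋯ ⊗ η`. This turns the absolute error `ε ‖S η‖^d` into the normalized criterion. -/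
theorem pow_le_norm_tensorPowMap (S : F →L[ℝ] G) (d : ℕ) {η : F} (hη : ‖η‖ = 1) :
    ‖S η‖ ^ d ≤ ‖tensorPowMap S d‖ := by
  have h := (tensorPowMap S d).le_opNorm (algTensorIncl F d (algPureTensor d fun _ => η))
  rw [tensorPowMap_algTensorIncl, norm_algTensorIncl, norm_algTensorIncl,
    algTensorMap_algPureTensor, norm_algPureTensor, norm_algPureTensor] at h
  simpa [hη] using h

variable [CompleteSpace F] [RKHS ℝ F X ℝ]

/-- Function values on the algebraic tensor power. -/
noncomputable def algStdInfo (F : Type u) [NormedAddCommGroup F] [InnerProductSpace ℝ F]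
    [CompleteSpace F] [RKHS ℝ F X ℝ] (d : ℕ) : Set ((algTensorPow F d).carrier →L[ℝ] ℝ) :=
  Set.range fun x : Fin d → X => innerSL ℝ (algPureTensor d fun i => kernelSection F (x i))

theorem tensorInfo_subset_algStdInfo (d : ℕ) :
    tensorInfo (algStdInfo F d) (stdInfo F) ⊆ (algStdInfo F (d + 1) :
      Set ((algTensorPow F d).carrier ⊗[ℝ] F →L[ℝ] ℝ)) := by
  rintro φ ⟨_, ⟨x, rfl⟩, _, ⟨t, rfl⟩, hφ⟩
  refine ⟨Fin.snoc (α := fun _ => X) x t, ?_⟩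
  refine tensor_clm_ext fun a f => ?_
  rw [hφ]
  change inner ℝ ((algPureTensor d fun i => kernelSection F
    (Fin.snoc (α := fun _ => X) x t i.castSucc)) ⊗ₜ[ℝ] kernelSection F
      (Fin.snoc (α := fun _ => X) x t (Fin.last d))) (a ⊗ₜ[ℝ] f) = _
  simp only [Fin.snoc_castSucc, Fin.snoc_last]
  rw [TensorProduct.inner_tmul, inner_kernelSection_left]
  rfl

theorem exists_algorithm_algTensorMap {S : F →L[ℝ] G} {η : F} (hη : ‖η‖ = 1)
    (hSη : ‖S‖ ≤ ‖S η‖)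
    (horth : ∀ v, inner ℝ (S η) (S v) = ‖S η‖ ^ 2 * inner ℝ η v)
    {Δ : ℕ → F →L[ℝ] G} {m : ℕ → ℕ} {a : ℕ → ℝ} {τ : ℝ}
    (hΔ : IsMultilevel (stdInfo F) S η Δ m a τ)
    (hτ : τ < ‖S η‖) {p b : ℝ} (hp : 0 ≤ p) (hb0 : 0 ≤ b)
    (hb : ∀ L, ∑ l ∈ Finset.range L, m l * a l ^ (-p) ≤ b) (d : ℕ) {ε : ℝ} (hε : 0 < ε) :
    ∃ n, ∃ A ∈ algorithms (algStdInfo F d) (algTensorMap S d) n,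
      (n : ℝ) ≤ (1 + b) ^ d * ε ^ (-p) ∧ ‖algTensorMap S d - A‖ ≤ ε * ‖S η‖ ^ d := by
  induction d generalizing ε with
  | zero =>
    -- Tolerances above `1` must be covered, since the induction calls on `a l * ε`. There the bound
    -- `ε ^ (-p)` may be below `1`, so only the zero algorithm is safe; for `ε < 1` one functional
    -- is affordable and exact.
    rcases le_or_gt 1 ε with h1 | h1
    · refine ⟨0, 0, algorithms_zero_mem, ?_, ?_⟩
      · simp only [Nat.cast_zero]; positivity
      · rw [sub_zero]
        refine (norm_algTensorMap_le S 0).trans ?_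
        simpa using h1
    · let e : (algTensorPow F 0).carrier := algPureTensor 0 Fin.elim0
      have he : innerSL ℝ e ∈ algStdInfo F 0 := ⟨Fin.elim0, rfl⟩
      refine ⟨1, (innerSL ℝ e).smulRight (algTensorMap S 0 e),
        algorithms_single he ⟨e, rfl⟩, ?_, ?_⟩
      · rw [pow_zero, one_mul, Nat.cast_one]
        exact Real.one_le_rpow_of_pos_of_le_one_of_nonpos hε h1.le (by linarith)
      · have h0 : algTensorMap S 0 = (innerSL ℝ e).smulRight (algTensorMap S 0 e) := by
          ext x
          apply ULift.ext
          change (x : ULift.{u} ℝ).down = (1 * (x : ULift.{u} ℝ).down) * 1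
          ring
        rw [← h0, sub_self, norm_zero]
        positivity
  | succ d ih =>
    obtain ⟨n, A, hA, hn, h⟩ := exists_algorithm_mapL hη horth hΔ hτ hb
      ((norm_algTensorMap_le S d).trans (pow_le_pow_left₀ (norm_nonneg _) hSη d))
      (by positivity) (fun ε hε => ih hε) hε
    refine ⟨n, A, algorithms_mono_info (tensorInfo_subset_algStdInfo d) hA, ?_, ?_⟩
    · rw [pow_succ']; exact hn
    · rw [pow_succ]; exact h

/-- The same nodes and outputs serve on the completion: the two error operators agree on a dense
subspace, and the norm bound extends by continuity. -/
theorem exists_algorithm_tensorPowMap {S : F →L[ℝ] G} {d n : ℕ}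
    {A : (algTensorPow F d).carrier →L[ℝ] (algTensorPow G d).carrier}
    (hA : A ∈ algorithms (algStdInfo F d) (algTensorMap S d) n) :
    ∃ B ∈ algorithms (stdInfo (TensorPow F d)) (tensorPowMap S d) n,
      ‖tensorPowMap S d - B‖ ≤ ‖algTensorMap S d - A‖ := by
  obtain ⟨L, g, hL, hg, rfl⟩ := hA
  choose x hx using hL
  choose y hy using hg
  refine ⟨∑ j, (ContinuousLinearMap.proj (x j) ∘L
    RKHS.coeCLM ℝ (H := TensorPow F d)).smulRight (algTensorIncl G d (g j)),
    ⟨_, _, fun j => ⟨x j, rfl⟩, fun j => ⟨algTensorIncl F d (y j), ?_⟩, rfl⟩, ?_⟩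
  · rw [tensorPowMap_algTensorIncl, hy]
  refine ContinuousLinearMap.opNorm_le_bound _ (norm_nonneg _) fun z => ?_
  refine (denseRange_algTensorIncl d).induction_on z
    (isClosed_le (by fun_prop) (by fun_prop)) fun a => ?_
  have hval : ∀ j, (ContinuousLinearMap.proj (x j) ∘L RKHS.coeCLM ℝ (H := TensorPow F d))
      (algTensorIncl F d a) = L j a := fun j => by
    rw [← hx j]
    exact UniformSpace.Completion.inner_coe _ _
  have : (tensorPowMap S d - ∑ j, (ContinuousLinearMap.proj (x j) ∘L
      RKHS.coeCLM ℝ (H := TensorPow F d)).smulRight (algTensorIncl G d (g j)))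
      (algTensorIncl F d a) =
      algTensorIncl G d ((algTensorMap S d - ∑ j, (L j).smulRight (g j)) a) := by
    rw [sub_apply, sub_apply, tensorPowMap_algTensorIncl, map_sub, sum_apply, sum_apply, map_sum]
    congr 1
    refine Finset.sum_congr rfl fun j _ => ?_
    rw [ContinuousLinearMap.smulRight_apply, ContinuousLinearMap.smulRight_apply, hval, map_smul]
  rw [this, norm_algTensorIncl, norm_algTensorIncl]
  exact ContinuousLinearMap.le_opNorm _ a

omit [CompleteSpace F] in
theorem infoComplexity_le_of_mem {Λ : Set (F →L[ℝ] ℝ)} {S A : F →L[ℝ] G} {n : ℕ} {ε : ℝ}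
    (hA : A ∈ algorithms Λ S n) (h : ‖S - A‖ ≤ ε * ‖S‖) : infoComplexity Λ S ε ≤ n :=
  iInf₂_le n ⟨A, hA, h⟩

end TensorPowers

/-! ### Multilevel decomposition from polynomial decay -/

section OffLeading

variable {F : Type u} [NormedAddCommGroup F] [InnerProductSpace ℝ F]
  {G : Type v} [NormedAddCommGroup G] [InnerProductSpace ℝ G]

theorem starProjection_orthogonal_singleton_apply {η : F} (hη : ‖η‖ = 1) (f : F) :
    (ℝ ∙ η)ᗮ.starProjection f = f - (inner ℝ η f : ℝ) • η := by
  rw [Submodule.starProjection_orthogonal_val, Submodule.starProjection_unit_singleton ℝ hη]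

/-- The compression of `B` to the orthogonal complements of `η` and `S η`. -/
noncomputable def offLeadingPart (S : F →L[ℝ] G) (η : F) (B : F →L[ℝ] G) : F →L[ℝ] G :=
  (ℝ ∙ S η)ᗮ.starProjection ∘L B ∘L (ℝ ∙ η)ᗮ.starProjection

theorem offLeadingPart_sub (S : F →L[ℝ] G) (η : F) (B C : F →L[ℝ] G) :
    offLeadingPart S η (B - C) = offLeadingPart S η B - offLeadingPart S η C := by
  rw [offLeadingPart, ContinuousLinearMap.sub_comp, ContinuousLinearMap.comp_sub]
  rfl

theorem norm_offLeadingPart_le (S : F →L[ℝ] G) (η : F) (B : F →L[ℝ] G) :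
    ‖offLeadingPart S η B‖ ≤ ‖B‖ := by
  refine ContinuousLinearMap.opNorm_le_bound _ (norm_nonneg _) fun f => ?_
  refine (Submodule.norm_starProjection_apply_le _ _).trans ?_
  refine (B.le_opNorm _).trans ?_
  gcongr
  exact Submodule.norm_starProjection_apply_le _ _

theorem isOffLeading_offLeadingPart (S : F →L[ℝ] G) (η : F) (B : F →L[ℝ] G) :
    IsOffLeading S η (offLeadingPart S η B) := by
  refine ⟨?_, fun f => ?_⟩
  · have h : (ℝ ∙ η)ᗮ.starProjection η = 0 := by
      rw [Submodule.starProjection_orthogonal_val,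
        Submodule.starProjection_eq_self_iff.mpr (Submodule.mem_span_singleton_self η), sub_self]
    rw [offLeadingPart, ContinuousLinearMap.comp_apply, ContinuousLinearMap.comp_apply, h, map_zero,
      map_zero]
  · exact Submodule.mem_orthogonal_singleton_iff_inner_right.mp
      (Submodule.starProjection_apply_mem _ _)

/-- By `horth`, `S` maps `ηᗮ` into `(S η)ᗮ`, hence intertwines the two projections. In particular,
projected outputs stay in the range of `S`. -/
theorem starProjection_orthogonal_apply_eq {S : F →L[ℝ] G} {η : F} (hη : ‖η‖ = 1)
    (horth : ∀ v, inner ℝ (S η) (S v) = ‖S η‖ ^ 2 * inner ℝ η v) (f : F) :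
    (ℝ ∙ S η)ᗮ.starProjection (S f) = S ((ℝ ∙ η)ᗮ.starProjection f) := by
  have h1 : S f = S ((ℝ ∙ η)ᗮ.starProjection f) + (inner ℝ η f : ℝ) • S η := by
    rw [starProjection_orthogonal_singleton_apply hη, map_sub, map_smul, sub_add_cancel]
  have h2 : (ℝ ∙ S η)ᗮ.starProjection (S η) = 0 := by
    rw [Submodule.starProjection_orthogonal_val,
      Submodule.starProjection_eq_self_iff.mpr (Submodule.mem_span_singleton_self _), sub_self]
  rw [h1, map_add, map_smul, h2, smul_zero, add_zero, Submodule.starProjection_eq_self_iff,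
    Submodule.mem_orthogonal_singleton_iff_inner_right, horth,
    Submodule.mem_orthogonal_singleton_iff_inner_right.mp (Submodule.starProjection_apply_mem _ f),
    mul_zero]

theorem offLeadingPart_self {S : F →L[ℝ] G} {η : F} (hη : ‖η‖ = 1)
    (horth : ∀ v, inner ℝ (S η) (S v) = ‖S η‖ ^ 2 * inner ℝ η v) :
    offLeadingPart S η S = S - leadingPart S η := by
  ext f
  rw [offLeadingPart, ContinuousLinearMap.comp_apply, ContinuousLinearMap.comp_apply,
    starProjection_orthogonal_apply_eq hη horth,
    Submodule.starProjection_eq_self_iff.mpr (Submodule.starProjection_apply_mem _ _),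
    starProjection_orthogonal_singleton_apply hη, map_sub, map_smul]
  rfl

theorem norm_sub_leadingPart_le {S : F →L[ℝ] G} {η : F} (hη : ‖η‖ = 1) {ρ : ℝ} (hρ : 0 ≤ ρ)
    (hSρ : ∀ v, inner ℝ η v = 0 → ‖S v‖ ≤ ρ * ‖v‖) : ‖S - leadingPart S η‖ ≤ ρ := by
  refine ContinuousLinearMap.opNorm_le_bound _ hρ fun f => ?_
  have h : (S - leadingPart S η) f = S ((ℝ ∙ η)ᗮ.starProjection f) := by
    rw [starProjection_orthogonal_singleton_apply hη, map_sub, map_smul]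
    rfl
  rw [h]
  refine (hSρ _ (Submodule.mem_orthogonal_singleton_iff_inner_right.mp
    (Submodule.starProjection_apply_mem _ f))).trans ?_
  gcongr
  exact Submodule.norm_starProjection_apply_le _ _

/-- Projecting the input subtracts `⟪η, f⟫ L j η` from each `L j f`. All these corrections use the
same coefficient `⟪η, f⟫ = a * L₀ f`, so one extra functional suffices. -/
theorem offLeadingPart_mem {Λ : Set (F →L[ℝ] ℝ)} {S : F →L[ℝ] G} {η : F} (hη : ‖η‖ = 1)
    (horth : ∀ v, inner ℝ (S η) (S v) = ‖S η‖ ^ 2 * inner ℝ η v)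
    {L₀ : F →L[ℝ] ℝ} (hL₀ : L₀ ∈ Λ) {a : ℝ} (ha : ∀ f, inner ℝ η f = a * L₀ f)
    {n : ℕ} {A : F →L[ℝ] G} (hA : A ∈ algorithms Λ S n) :
    offLeadingPart S η A ∈ algorithms Λ S (n + 1) := by
  obtain ⟨L, g, hL, hg, rfl⟩ := hA
  have hg' : ∀ j, (ℝ ∙ S η)ᗮ.starProjection (g j) ∈ Set.range S := fun j => by
    obtain ⟨x, hx⟩ := hg j
    exact ⟨_, by rw [← hx, starProjection_orthogonal_apply_eq hη horth]⟩
  choose y hy using hg'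
  have key : offLeadingPart S η (∑ j, (L j).smulRight (g j)) =
      ∑ j, (L j).smulRight (S (y j)) + L₀.smulRight (S (-(a • ∑ j, L j η • y j))) := by
    ext f
    simp only [offLeadingPart, ContinuousLinearMap.comp_apply, add_apply, sum_apply,
      ContinuousLinearMap.smulRight_apply, map_smul, map_sum, map_neg, ← hy]
    rw [smul_neg, ← sub_eq_add_neg, Finset.smul_sum, Finset.smul_sum, ← Finset.sum_sub_distrib]
    refine Finset.sum_congr rfl fun j _ => ?_
    rw [starProjection_orthogonal_singleton_apply hη, map_sub, map_smul, ha, smul_eq_mul]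
    module
  rw [key]
  exact algorithms_add ⟨L, _, hL, fun j => ⟨y j, rfl⟩, rfl⟩ (algorithms_single hL₀ ⟨_, rfl⟩)

/-- Along dyadic budgets polynomial decay of order `r` becomes geometric decay with ratio `2 ^
(-r)`; `N` is large enough to make the constant `δ` as small as desired. -/
theorem exists_algorithm_norm_le_geometric {Λ : Set (F →L[ℝ] ℝ)} (hΛ : Λ.Nonempty)
    {S : F →L[ℝ] G} {r : ℝ} (hr : 0 < r)
    (h : Tendsto (fun n : ℕ => (n : ℝ) ^ r * minimalError Λ S n) atTop (𝓝 0)) {δ : ℝ}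
    (hδ : 0 < δ) :
    ∃ N : ℕ, 1 ≤ N ∧ ∀ l : ℕ, ∃ A ∈ algorithms Λ S (N * 2 ^ l),
      ‖S - A‖ ≤ δ * ((2 : ℝ) ^ (-r)) ^ l := by
  obtain ⟨N₀, hN₀⟩ := eventually_atTop.mp (h.eventually_lt_const hδ)
  refine ⟨max N₀ 1, le_max_right _ _, fun l => ?_⟩
  set N := max N₀ 1 with hN
  have h2 : 1 ≤ 2 ^ l := Nat.one_le_two_pow
  have hNl : N₀ ≤ N * 2 ^ l := (le_max_left _ _).trans (Nat.le_mul_of_pos_right _ h2)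
  have hle : ((2 : ℝ) ^ l) ≤ ((N * 2 ^ l : ℕ) : ℝ) := by
    exact_mod_cast Nat.le_mul_of_pos_left _ (lt_of_lt_of_le one_pos (le_max_right _ _))
  have h3 := hN₀ _ hNl
  have hlt : minimalError Λ S (N * 2 ^ l) < δ * ((2 : ℝ) ^ (-r)) ^ l := by
    rw [Real.rpow_pow_comm (by norm_num), Real.rpow_neg (by positivity), ← div_eq_mul_inv,
      lt_div_iff₀' (by positivity)]
    refine lt_of_le_of_lt ?_ h3
    refine mul_le_mul_of_nonneg_right ?_ (minimalError_nonneg _ _ _)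
    exact Real.rpow_le_rpow (by positivity) hle hr.le
  obtain ⟨A, hA, hA'⟩ := exists_algorithm_norm_lt hΛ hlt
  exact ⟨A, hA, hA'.le⟩

theorem exists_isMultilevel {Λ : Set (F →L[ℝ] ℝ)} {S : F →L[ℝ] G} {η : F} (hη : ‖η‖ = 1)
    (horth : ∀ v, inner ℝ (S η) (S v) = ‖S η‖ ^ 2 * inner ℝ η v)
    {L₀ : F →L[ℝ] ℝ} (hL₀ : L₀ ∈ Λ) {c : ℝ} (hc : ∀ f, inner ℝ η f = c * L₀ f)
    {ρ : ℝ} (hρ : 0 < ρ) (hρS : ρ < ‖S η‖) (hSρ : ∀ v, inner ℝ η v = 0 → ‖S v‖ ≤ ρ * ‖v‖)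
    (hdecay : 0 < decay (minimalError Λ S)) :
    ∃ (α β τ M : ℝ) (Δ : ℕ → F →L[ℝ] G) (m : ℕ → ℕ), 1 < α ∧ 1 < β ∧ τ < ‖S η‖ ∧ 0 < M ∧
      (∀ l, (m l : ℝ) ≤ M * 2 ^ l) ∧ IsMultilevel Λ S η Δ m (fun l => α * β ^ l) τ := by
  obtain ⟨r, hr, hlim⟩ := decay_pos_iff.mp hdecay
  set γ : ℝ := (2 : ℝ) ^ (-r) with hγ
  have hγ0 : 0 < γ := by positivity
  have hγ1 : γ < 1 := Real.rpow_lt_one_of_one_lt_of_neg (by norm_num) (by linarith)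
  -- The weights `α β^l` may grow, but slower than the levels shrink (`β γ < 1`), and the first
  -- weight must keep `α ρ` below `‖S η‖`. Then `δ` is chosen so that `δ K` is half the remaining
  -- gap.
  obtain ⟨β, hβ1, hβ⟩ := exists_between ((one_lt_inv₀ hγ0).mpr hγ1)
  have hβγ : β * γ < 1 := (lt_inv_mul_iff₀' hγ0).mp (by rwa [mul_one])
  have hβ0 : 0 < β := by linarith
  obtain ⟨α, hα1, hα⟩ := exists_between ((one_lt_div hρ).mpr hρS)
  have hαρ : α * ρ < ‖S η‖ := (lt_div_iff₀ hρ).mp hα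
  have hα0 : 0 < α := by linarith
  set K : ℝ := α * (1 + 2 * β / (1 - β * γ)) with hK
  have hden : 0 < 1 - β * γ := by linarith
  have hK0 : 0 < K := by positivity
  set δ : ℝ := (‖S η‖ - α * ρ) / (2 * K) with hδ
  have hδ0 : 0 < δ := div_pos (by linarith) (by positivity)
  have hδK : α * ρ + δ * K < ‖S η‖ := by
    have : δ * K = (‖S η‖ - α * ρ) / 2 := by rw [hδ]; field_simp
    linarith
  obtain ⟨N, hN, hA⟩ := exists_algorithm_norm_le_geometric ⟨L₀, hL₀⟩ hr hlim hδ0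
  choose A hA hSA using hA
  set S₁ := S - leadingPart S η with hS₁
  have hS₁' : offLeadingPart S η S = S₁ := offLeadingPart_self hη horth
  -- The levels are the increments of this sequence. Starting from `B 0 = 0` makes the first
  -- increment nearly the whole remainder, of norm at most `ρ + δ`; later ones are at most `2 δ
  -- γ^l`.
  let B : ℕ → F →L[ℝ] G := fun l => Nat.casesOn l 0 fun l => offLeadingPart S η (A l)
  let k : ℕ → ℕ := fun l => Nat.casesOn l 0 fun l => N * 2 ^ l + 1
  have hB : ∀ l, B l ∈ algorithms Λ S (k l) := by
    rintro (_ | l)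
    · exact algorithms_zero_mem
    · exact offLeadingPart_mem hη horth hL₀ hc (hA l)
  have hBoff : ∀ l, IsOffLeading S η (B l) := by
    rintro (_ | l)
    · exact ⟨rfl, fun f => inner_zero_right _⟩
    · exact isOffLeading_offLeadingPart _ _ _
  have hSB : ∀ l, ‖S₁ - B (l + 1)‖ ≤ δ * γ ^ l := fun l => by
    change ‖S₁ - offLeadingPart S η (A l)‖ ≤ _
    rw [← hS₁', ← offLeadingPart_sub]
    exact (norm_offLeadingPart_le _ _ _).trans (hSA l)
  have hS₁ρ : ‖S₁‖ ≤ ρ := norm_sub_leadingPart_le hη hρ.le hSρ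
  have hsum : ∀ L, ∑ l ∈ Finset.range L, (B (l + 1) - B l) = B L := fun L => by
    rw [Finset.sum_range_sub]
    exact sub_zero _
  have hfirst : ‖B 1 - B 0‖ ≤ ρ + δ := by
    have h1 : B 1 - B 0 = S₁ - (S₁ - B 1) := by
      rw [sub_sub_cancel]; exact sub_zero _
    rw [h1]
    refine (norm_sub_le _ _).trans (add_le_add hS₁ρ ?_)
    simpa using hSB 0
  have hnext : ∀ l, ‖B (l + 1 + 1) - B (l + 1)‖ ≤ 2 * δ * γ ^ l := fun l => by
    have h1 : B (l + 1 + 1) - B (l + 1) = (S₁ - B (l + 1)) - (S₁ - B (l + 1 + 1)) := by abel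
    rw [h1]
    refine (norm_sub_le _ _).trans ((add_le_add (hSB l) (hSB (l + 1))).trans ?_)
    have h2 : γ ^ (l + 1) ≤ γ ^ l := pow_le_pow_of_le_one hγ0.le hγ1.le (Nat.le_succ l)
    nlinarith
  refine ⟨α, β, α * ρ + δ * K, 2 * (N + 1), fun l => B (l + 1) - B l, fun l => k (l + 1) + k l,
    hα1, hβ1, hδK, by positivity, fun l => ?_, ?_⟩
  · have h1 : k l ≤ k (l + 1) := by
      rcases l with _ | l
      · exact Nat.zero_le _
      · change N * 2 ^ l + 1 ≤ N * 2 ^ (l + 1) + 1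
        gcongr <;> omega
    have h2 : k (l + 1) ≤ (N + 1) * 2 ^ l := by
      change N * 2 ^ l + 1 ≤ _
      have : 1 ≤ 2 ^ l := Nat.one_le_two_pow
      linarith
    have h3 : k (l + 1) + k l ≤ 2 * (N + 1) * 2 ^ l := by linarith
    exact_mod_cast h3
  · refine ⟨fun l => by positivity, ?_, fun l => ?_, fun l => (hBoff (l + 1)).sub (hBoff l), fun L => ?_,
      ?_⟩
    · have : leadingPart S η = L₀.smulRight (S (c • η)) := by
        ext f
        rw [leadingPart_apply, hc, ContinuousLinearMap.smulRight_apply, map_smul, smul_smul,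
          mul_comm]
      rw [this]
      exact algorithms_single hL₀ ⟨_, rfl⟩
    · rw [sub_eq_add_neg]
      exact algorithms_add (hB (l + 1)) (algorithms_neg (hB l))
    · calc ∑ l ∈ Finset.range L, α * β ^ l * ‖B (l + 1) - B l‖
          -- One more nonnegative term makes the range nonempty, so the exceptional first level can
          -- be split off.
          ≤ ∑ l ∈ Finset.range (L + 1), α * β ^ l * ‖B (l + 1) - B l‖ :=
            Finset.sum_le_sum_of_subset_of_nonneg (Finset.range_mono (Nat.le_succ L))
              fun l _ _ => by positivity
        _ = ∑ l ∈ Finset.range L, α * β ^ (l + 1) * ‖B (l + 1 + 1) - B (l + 1)‖ +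
              α * β ^ 0 * ‖B (0 + 1) - B 0‖ := Finset.sum_range_succ' _ _
        _ ≤ ∑ l ∈ Finset.range L, (2 * α * β * δ) * (β * γ) ^ l + α * (ρ + δ) := by
            refine add_le_add (Finset.sum_le_sum fun l _ => ?_) ?_
            · calc α * β ^ (l + 1) * ‖B (l + 1 + 1) - B (l + 1)‖
                  ≤ α * β ^ (l + 1) * (2 * δ * γ ^ l) := by gcongr; exact hnext l
                _ = _ := by rw [mul_pow]; ring
            · rw [pow_zero, mul_one]
              gcongr
              exact hfirst
        _ ≤ (2 * α * β * δ) * (1 - β * γ)⁻¹ + α * (ρ + δ) := by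
            rw [← Finset.mul_sum]
            gcongr
            rw [← tsum_geometric_of_lt_one (by positivity) hβγ]
            exact (summable_geometric_of_lt_one (by positivity) hβγ).sum_le_tsum _
              fun i _ => by positivity
        _ = α * ρ + δ * K := by rw [hK]; field_simp; ring
    · simp only [hsum]
      rw [← tendsto_add_atTop_iff_nat 1]
      refine squeeze_zero (fun _ => norm_nonneg _) hSB ?_
      simpa using (tendsto_pow_atTop_nhds_zero_of_lt_one hγ0.le hγ1).const_mul δ

end OffLeading

/-! ### Quasi-polynomial tractability -/

section QPT

/-- With `β^t ≥ 4` the factor `β^(-p l)` beats the growth `2^l` of the costs and leaves a sum of at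
most `2`. With `α^t ≥ max (2M) e`, `α^p = α^t (α^t)^(ln d) ≥ 2 M d` supplies the `1/d`. The choice
of `t` is independent of `d`. -/
theorem exists_exponent_sum_le {α β M : ℝ} (hα : 1 < α) (hβ : 1 < β) (hM : 0 < M) :
    ∃ t : ℝ, 0 ≤ t ∧ ∀ m : ℕ → ℕ, (∀ l, (m l : ℝ) ≤ M * 2 ^ l) → ∀ d : ℕ, 1 ≤ d → ∀ L : ℕ,
      ∑ l ∈ Finset.range L, m l * (α * β ^ l) ^ (-(t * (1 + Real.log d))) ≤ 1 / d := by
  have h1 := (tendsto_rpow_atTop_of_base_gt_one α hα).eventually_ge_atTop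
    (max (2 * M) (Real.exp 1))
  have h2 := (tendsto_rpow_atTop_of_base_gt_one β hβ).eventually_ge_atTop 4
  obtain ⟨t, ⟨hαt, hβt⟩, ht⟩ := ((h1.and h2).and (eventually_ge_atTop 0)).exists
  refine ⟨t, ht, fun m hm d hd L => ?_⟩
  have hd0 : (0 : ℝ) < d := by exact_mod_cast hd
  have hlog : 0 ≤ Real.log d := Real.log_natCast_nonneg d
  set p := t * (1 + Real.log d) with hp
  have hα0 : 0 < α := by linarith
  have hβ0 : 0 < β := by linarith
  have htp : t ≤ p := by rw [hp]; nlinarith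
  have hβp : β ^ (-p) ≤ 1 / 4 := by
    rw [Real.rpow_neg hβ0.le, ← one_div]
    exact one_div_le_one_div_of_le (by norm_num)
      (hβt.trans (Real.rpow_le_rpow_of_exponent_le hβ.le htp))
  have hαp : α ^ (-p) ≤ 1 / (2 * M * d) := by
    rw [Real.rpow_neg hα0.le, ← one_div]
    refine one_div_le_one_div_of_le (by positivity) ?_
    rw [hp, Real.rpow_mul hα0.le, Real.rpow_add (by positivity), Real.rpow_one]
    refine mul_le_mul ((le_max_left _ _).trans hαt) ?_ hd0.le (by positivity)
    calc (d : ℝ) = Real.exp 1 ^ Real.log d := by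
          rw [← Real.exp_mul, one_mul, Real.exp_log hd0]
      _ ≤ _ := Real.rpow_le_rpow (by positivity) ((le_max_right _ _).trans hαt) hlog
  calc ∑ l ∈ Finset.range L, m l * (α * β ^ l) ^ (-p)
      ≤ ∑ l ∈ Finset.range L, (M * α ^ (-p)) * (1 / 2) ^ l := by
        refine Finset.sum_le_sum fun l _ => ?_
        rw [Real.mul_rpow hα0.le (by positivity), ← Real.rpow_pow_comm hβ0.le]
        calc m l * (α ^ (-p) * (β ^ (-p)) ^ l) ≤ (M * 2 ^ l) * (α ^ (-p) * (1 / 4) ^ l) := by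
              gcongr
              exact hm l
          _ = (M * α ^ (-p)) * (2 * (1 / 4)) ^ l := by rw [mul_pow]; ring
          _ = _ := by norm_num
    _ ≤ (M * α ^ (-p)) * 2 := by
        rw [← Finset.mul_sum]
        gcongr
        refine le_of_le_of_eq ?_ tsum_geometric_two
        exact summable_geometric_two.sum_le_tsum _ fun i _ => by positivity
    _ ≤ (M * (1 / (2 * M * d))) * 2 := by gcongr
    _ = 1 / d := by field_simp

variable {X : Type w} {F : Type u} [NormedAddCommGroup F] [InnerProductSpace ℝ F]
  {G : Type v} [NormedAddCommGroup G] [InnerProductSpace ℝ G]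
  [CompleteSpace F] [RKHS ℝ F X ℝ]

/-- Tensor powers are quasi-polynomially tractable if the top singular value is simple, the
univariate errors decay polynomially, and the top singular vector is proportional to a kernel
section. -/
theorem isQPTStd_tensorPowMap {S : F →L[ℝ] G} {η : F} (hη : ‖η‖ = 1) (hSη : ‖S‖ ≤ ‖S η‖)
    (horth : ∀ v, inner ℝ (S η) (S v) = ‖S η‖ ^ 2 * inner ℝ η v)
    {t : X} {c : ℝ} (hc : ∀ f : F, inner ℝ η f = c * f t)
    {ρ : ℝ} (hρ : 0 < ρ) (hρS : ρ < ‖S η‖) (hSρ : ∀ v, inner ℝ η v = 0 → ‖S v‖ ≤ ρ * ‖v‖)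
    (hdecay : 0 < decay (minimalError (stdInfo F) S)) :
    IsQPTStd (fun d : ℕ => tensorPowMap S d) := by
  obtain ⟨α, β, τ, M, Δ, m, hα, hβ, hτ, hM, hm, hΔ⟩ :=
    exists_isMultilevel hη horth (Λ := stdInfo F) (Set.mem_range_self t) hc hρ hρS hSρ hdecay
  obtain ⟨q, hq0, hq⟩ := exists_exponent_sum_le hα hβ hM
  refine ⟨Real.exp 1, q, (Real.exp_pos 1).le, hq0, fun ε hε hε1 d hd => ?_⟩
  have hd0 : (0 : ℝ) < d := by exact_mod_cast hd
  have hlog : 0 ≤ Real.log d := Real.log_natCast_nonneg d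
  have hp : 0 ≤ q * (1 + Real.log d) := by positivity
  obtain ⟨n, A, hA, hn, hSA⟩ := exists_algorithm_algTensorMap hη hSη horth hΔ hτ hp
    (by positivity) (hq m hm d hd) d hε
  obtain ⟨B, hB, hSB⟩ := exists_algorithm_tensorPowMap hA
  have hle : infoComplexity (stdInfo (TensorPow F d)) (tensorPowMap S d) ε ≤ n :=
    infoComplexity_le_of_mem hB (hSB.trans (hSA.trans (mul_le_mul_of_nonneg_left
      (pow_le_norm_tensorPowMap S d hη) hε.le)))
  have hpow : (1 + 1 / (d : ℝ)) ^ d ≤ Real.exp 1 := by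
    calc (1 + 1 / (d : ℝ)) ^ d ≤ (Real.exp (1 / d)) ^ d := by
          gcongr
          rw [add_comm]
          exact Real.add_one_le_exp _
      _ = Real.exp 1 := by
          rw [← Real.exp_nat_mul, mul_one_div_cancel hd0.ne']
  -- The left side is `exp (q (1 + ln d) ln ε⁻¹)`; the summand `1` next to `ln ε⁻¹` is slack.
  have hεp : ε ^ (-(q * (1 + Real.log d))) ≤
      Real.exp (q * (1 + Real.log ε⁻¹) * (1 + Real.log d)) := by
    rw [Real.rpow_def_of_pos hε, Real.exp_le_exp, Real.log_inv]
    linarith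
  have hn' : (n : ℝ) ≤ Real.exp 1 * Real.exp (q * (1 + Real.log ε⁻¹) * (1 + Real.log d)) :=
    hn.trans (mul_le_mul hpow hεp (by positivity) (Real.exp_pos 1).le)
  calc (infoComplexity (stdInfo (TensorPow F d)) (tensorPowMap S d) ε : ℝ≥0∞)
      ≤ ((n : ℕ∞) : ℝ≥0∞) := ENat.toENNReal_le.mpr hle
    _ = ENNReal.ofReal (n : ℝ) := by simp
    _ ≤ _ := ENNReal.ofReal_le_ofReal hn'

end QPT

/-- Leading part and remainder act between orthogonal pieces, so the norm of `S` is at most the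
larger of the two, and the leading part has norm `‖S η‖`. -/
theorem norm_le_of_norm_le_on_orthogonal {F : Type u} [NormedAddCommGroup F] [InnerProductSpace ℝ F]
    {G : Type v} [NormedAddCommGroup G] [InnerProductSpace ℝ G] {S : F →L[ℝ] G} {η : F}
    (hη : ‖η‖ = 1) (horth : ∀ v, inner ℝ (S η) (S v) = ‖S η‖ ^ 2 * inner ℝ η v)
    (h : ∀ v, inner ℝ η v = 0 → ‖S v‖ ≤ ‖S η‖ * ‖v‖) : ‖S‖ ≤ ‖S η‖ := by
  have hηη : inner ℝ η η = (1 : ℝ) := by rw [real_inner_self_eq_norm_sq, hη, one_pow]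
  have hR := isOffLeading_sub_leadingPart hη horth
  suffices h' : ‖leadingPart S η + (S - leadingPart S η)‖ ≤ ‖S η‖ by
    rwa [add_sub_cancel] at h'
  refine opNorm_add_le_of_orthogonal _ _ (ℝ ∙ η).starProjection (ℝ ∙ η)ᗮ.starProjection
    (fun z => ?_) (fun z => ?_) (fun z => ?_) (fun z => ?_) (fun z => ?_) ?_
    (norm_sub_leadingPart_le hη (norm_nonneg _) h)
  · exact Submodule.starProjection_add_starProjection_orthogonal _
  · exact (Submodule.starProjection_apply_mem _ z : (ℝ ∙ η)ᗮ.starProjection z ∈ (ℝ ∙ η)ᗮ) _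
      (Submodule.starProjection_apply_mem _ z)
  · rw [Submodule.starProjection_unit_singleton ℝ hη, leadingPart_apply, leadingPart_apply,
      real_inner_smul_right, hηη, mul_one]
  · rw [starProjection_orthogonal_singleton_apply hη, hR.apply_sub]
  · rw [leadingPart_apply, real_inner_smul_left, hR.2, mul_zero]
  · rw [leadingPart, ContinuousLinearMap.norm_smulRight_apply, innerSL_apply_norm, hη, one_mul]

/-! ### Assembly of the theorem -/

theorem mainTheorem3 {D : Set ℝ}
    {F : Type u} [NormedAddCommGroup F] [InnerProductSpace ℝ F] [CompleteSpace F] [RKHS ℝ F D ℝ]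
    {G : Type v} [NormedAddCommGroup G] [InnerProductSpace ℝ G] [CompleteSpace G]
    (S : F →L[ℝ] G) (hS0 : S ≠ 0) (hS : IsCompactOperator S)
    (hgap : orderedEigenvalue (S.adjoint ∘L S) 2 < orderedEigenvalue (S.adjoint ∘L S) 1)
    (hdecay : 0 < decay (minimalError (stdInfo F) S))
    (η : F) (hη : ‖η‖ = 1)
    (hη_eig : S.adjoint (S η) = orderedEigenvalue (S.adjoint ∘L S) 1 • η)
    (hη_sec : ∀ t : D, ¬ IsNormalizedKernelSectionAt η t) :
    (∃ t : D, η t ≠ 0) ∧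
    ∀ t : D, η t ≠ 0 →
      let F' : Submodule ℝ F := modifiedSpace η t
      let f' : F := modifier η t
      let S' : F' →L[ℝ] G := S ∘L F'.subtypeL
      let W : F →L[ℝ] F := S.adjoint ∘L S
      let W' : F' →L[ℝ] F' := S'.adjoint ∘L S'
      -- the modified space has codimension one, and its kernel is a rank-one modification
      f' ≠ 0 ∧ (∀ f : F, f ∈ F' ↔ inner ℝ f f' = 0) ∧ Module.finrank ℝ (F ⧸ F') = 1 ∧
      (∀ x y : D, realKernel F' x y = realKernel F x y - f' x * f' y / ‖f'‖ ^ 2) ∧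
      -- `η` belongs to it, is a normalized kernel section there and an eigenfunction of `W'`
      (∃ η' : F', (η' : F) = η ∧ 0 < realKernel F' t t ∧ IsNormalizedKernelSectionAt η' t ∧
        (0 < η t → η' = (√(realKernel F' t t))⁻¹ • kernelSection F' t) ∧
        W' η' = orderedEigenvalue W' 1 • η') ∧
      -- the eigenvalues
      orderedEigenvalue W' 1 = orderedEigenvalue W 1 ∧
      (∀ n : ℕ, 2 ≤ n → orderedEigenvalue W' n ≤ orderedEigenvalue W n) ∧
      -- the minimal errors for both classes of information
      (∀ n : ℕ, minimalError (stdInfo F') S' n ≤ minimalError (stdInfo F) S n) ∧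
      (∀ n : ℕ, minimalError (allInfo F') S' n ≤ minimalError (allInfo F) S n) ∧
      -- the restricted operator is non-zero and compact, with a spectral gap and polynomial decay
      S' ≠ 0 ∧ IsCompactOperator S' ∧ orderedEigenvalue W' 2 < orderedEigenvalue W' 1 ∧
      0 < decay (minimalError (stdInfo F') S') ∧
      -- quasi-polynomial tractability of the modified problem
      IsQPTStd (fun d : ℕ => tensorPowMap S' d) := by
  have hη0 : η ≠ 0 := by
    rintro rfl
    rw [norm_zero] at hη
    exact zero_ne_one hη
  refine ⟨?_, fun t ht => ?_⟩
  · by_contra! h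
    exact hη0 (RKHS.ext fun x => by rw [h x, RKHS.coe_zero, Pi.zero_apply])
  intro F' f' S' W W'
  have : Nonempty D := ⟨t⟩
  have hf' : f' ≠ 0 := modifier_ne_zero ht (hη_sec t)
  have hmem : η ∈ F' := mem_modifiedSpace_self hη ht
  have hW1 : orderedEigenvalue W' 1 = orderedEigenvalue W 1 :=
    orderedEigenvalue_one_restrict hS F' hη hmem hη_eig
  have hWn : ∀ n : ℕ, 1 ≤ n → orderedEigenvalue W' n ≤ orderedEigenvalue W n :=
    fun n hn => orderedEigenvalue_restrict_le hS F' hn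
  have hstd : ∀ n : ℕ, minimalError (stdInfo F') S' n ≤ minimalError (stdInfo F) S n :=
    fun n => minimalError_stdInfo_restrict_le S F' n
  have hdecay' : 0 < decay (minimalError (stdInfo F') S') :=
    decay_pos_of_le hdecay (fun n => minimalError_nonneg _ _ n) hstd
  have hW'η : W' ⟨η, hmem⟩ = orderedEigenvalue W' 1 • (⟨η, hmem⟩ : F') := by
    rw [hW1]
    exact adjoint_restrict_comp_restrict_apply S F' hη_eig
  have hK := realKernel_modifiedSpace_self ht hmem
  have hsec := isNormalizedKernelSectionAt_modifiedSpace ht hmem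
  have hS'cpt : IsCompactOperator S' := hS.comp_clm F'.subtypeL
  have hgap' : orderedEigenvalue W' 2 < orderedEigenvalue W' 1 := by
    rw [hW1]
    exact (hWn 2 one_le_two).trans_lt hgap
  have hη' : ‖(⟨η, hmem⟩ : F')‖ = 1 := hη
  -- The gap estimate is taken for the restricted operator. Its conclusion `0 < ρ < ‖S' η‖` also
  -- shows `S' ≠ 0`.
  obtain ⟨ρ, hρ, hρS, hSρ⟩ := exists_norm_le_on_orthogonal hS'cpt hgap' hη' hW'η
  have horth : ∀ v : F', inner ℝ (S' ⟨η, hmem⟩) (S' v) =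
      ‖S' ⟨η, hmem⟩‖ ^ 2 * inner ℝ (⟨η, hmem⟩ : F') v := fun v => by
    have h1 : ∀ v : F', inner ℝ (S' ⟨η, hmem⟩) (S' v) =
        orderedEigenvalue W' 1 * inner ℝ (⟨η, hmem⟩ : F') v := fun v => by
      rw [← ContinuousLinearMap.adjoint_inner_left, ← real_inner_smul_left, ← hW'η]
      rfl
    rw [← real_inner_self_eq_norm_sq (S' ⟨η, hmem⟩), h1, h1, real_inner_self_eq_norm_sq, hη',
      one_pow, mul_one]
  have hnorm : ‖S'‖ ≤ ‖S' ⟨η, hmem⟩‖ := norm_le_of_norm_le_on_orthogonal hη' horth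
    fun v hv => (hSρ v hv).trans (by gcongr)
  refine ⟨hf', fun f => mem_modifiedSpace_iff, finrank_quotient_modifiedSpace hf',
    realKernel_modifiedSpace hf', ⟨⟨η, hmem⟩, rfl, ?_, hsec.1, hsec.2, hW'η⟩, hW1,
    fun n hn => hWn n (one_le_two.trans hn), hstd,
    fun n => minimalError_restrict_le ⟨0, Set.mem_univ _⟩ S F' (fun _ _ => Set.mem_univ _) n, ?_, hS'cpt, hgap',
    hdecay', ?_⟩
  · rw [hK]
    exact mul_self_pos.mpr ht
  · intro h0
    have : S' ⟨η, hmem⟩ = 0 := by rw [h0]; rfl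
    rw [this, norm_zero] at hρS
    exact absurd hρS (not_lt.mpr hρ.le)
  -- Membership in the modified space says precisely that `⟪η, f⟫ = η(t)⁻¹ f(t)`, whence the
  -- constant `c`.
  · refine isQPTStd_tensorPowMap (t := t) (c := (η t)⁻¹) hη' hnorm horth (fun f => ?_) hρ hρS hSρ
      hdecay'
    rw [submodule_coe_apply, eval_eq_inner_of_mem_modifiedSpace ht f.2, inv_mul_cancel_left₀ ht]
    rfl
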